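/- Let $V$ be a grading-restricted vertex algebra, possibly with a conformal vector $\omega$ (in which case $V$ is a vertex operator algebra), and let $W_1,W_2,W_3$ be lower-bounded generalized $V$-modules: each $W=W_i$ is the direct sum of the generalized eigenspaces $W_{[h]}$, $h\in\mathbb C$, of $L_W(0)$, and the real parts of the eigenvalues are bounded below. If $V$ has a conformal vector, $L_W(0)$ and $L_W(-1)$ are the operators given by $Y_W(\omega,x)$. **Levels.** Call $h\in\mathbb C$ a minimal weight of $W$ if $W_{[h]}\neq 0$ and $W_{[h-m]}=0$ for all integers $m\ge 1$. For $n\in\mathbb N=\{0,1,2,\dots\}$ put $W_{\langle n\rangle}=\bigoplus_{h} W_{[h+n]}$, the sum over the minimal weights $h$ of $W$; then $W=\bigoplus_{n\in\mathbb N}W_{\langle n\rangle}$. Fix $N\in\mathbb N$ and put $\Omega_N^0(W)=\bigoplus_{n=0}^N W_{\langle n\rangle}$. The same definitions apply to the graded dual $W'=\bigoplus_h (W_{[h]})^*$. **The algebra $A^N(V)$.** For a vector space $X$ let $U^\infty(X)$ be the space of matrices $[x_{kl}]_{k,l\in\mathbb N}$ with entries in $X$ and only finitely many nonzero entries in each column,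 let $U^N(X)\subset U^\infty(X)$ be the space of those with $x_{kl}=0$ unless $k,l\le N$, and let $[x]_{kl}$ be the matrix whose only nonzero entry is $x$, at $(k,l)$. Define $\vartheta_W:U^\infty(V)\to \mathrm{End}\,W$ by $\vartheta_W([v]_{kl})w=\delta_{ln}\,\mathrm{Res}_x\,x^{l-k-1}Y_W(x^{L_V(0)}v,x)w$ for $w\in W_{\langle n\rangle}$. Let $Q^\infty(V)$ be the intersection of $\ker\vartheta_W$ over all lower-bounded generalized $V$-modules $W$, let $A^\infty(V)=U^\infty(V)/Q^\infty(V)$, and let $A^N(V)$ be the image of $U^N(V)$ in $A^\infty(V)$; it acts on $\Omega_N^0(W)$ through $\vartheta_W$. **Intertwining operators.** Let $\mathcal V_{W_1W_2}^{W_3}$ be the space of logarithmic intertwining operators $\mathcal Y(w_1,x)w_2=\sum_{n\in\mathbb C}\sum_{k\in\mathbb N}\mathcal Y_{n,k}(w_1)w_2\,x^{-n-1}(\log x)^k\in W_3[\log x]\{x\}$ of type $\binom{W_3}{W_1W_2}$ such that, for all $w_1,w_2$, the powers of $x$ in $\mathcal Y(w_1,x)w_2$ lie in finitely many congruence classes modulo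 $\mathbb Z$. (They satisfy lower truncation, the Jacobi identity, the $L(-1)$-derivative property and the commutator formulas with $L(-1)$ and $L(0)$; with a conformal vector these commutator formulas and the one with $L(1)$ follow from the Jacobi identity.) Let $\mathcal Y^0$ be the coefficient of $(\log x)^0$. Define $\vartheta_{\mathcal Y}:U^\infty(W_1)\to\mathrm{Hom}(W_2,W_3)$ as follows: for $w_1\in (W_1)_{[b]}$ and $w_2\in (W_2)_{[h_2+n]}$ with $h_2$ a minimal weight of $W_2$ and $n\in\mathbb N$, $$\vartheta_{\mathcal Y}([w_1]_{kl})w_2=\delta_{ln}\sum_{h_3}\mathrm{Res}_x\,x^{h_2-h_3+l-k-1}\,\mathcal Y^0(x^{b}w_1,x)w_2,$$ where $h_3$ runs over the minimal weights of $W_3$. **The bimodule $A^N(W)$.** Let $Q^\infty(W)$ be the intersection of $\ker\vartheta_{\mathcal Y}$ over all lower-bounded generalized $V$-modules $X_2,X_3$ and all such intertwining operators $\mathcal Y$ of type $\binom{X_3}{W\,X_2}$, let $A^\infty(W)=U^\infty(W)/Q^\infty(W)$, and let $A^N(W)$ be the image of $U^N(W)$. The left and right actions $\diamond$ of $A^N(V)$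 on $A^N(W)$ are induced by $[v]_{km}\diamond[w]_{nl}=0=[w]_{km}\diamond[v]_{nl}$ for $m\ne n$ and $$[v]_{kn}\diamond[w]_{nl}=\sum_{m=0}^{n}\binom{-k+n-l-1}{m}\mathrm{Res}_x\,x^{-k+n-l-m-1}(1+x)^{l}\bigl[Y_W((1+x)^{L_V(0)}v,x)w\bigr]_{kl},$$ $$[w]_{kn}\diamond[v]_{nl}=\sum_{m=0}^{n}\binom{-k+n-l-1}{m}\mathrm{Res}_x\,x^{-k+n-l-m-1}(1+x)^{k}\bigl[Y_W((1+x)^{-L_V(0)}v,-x(1+x)^{-1})w\bigr]_{kl}.$$ **Statement.** Assume that $W_2$ is generated by $\Omega_N^0(W_2)$ as a $V$-module and that $W_3'$ is generated by $\Omega_N^0(W_3')$, where the operators acting on $W_3'$ are the coefficients of the contragredient vertex operators, $\langle Y_{W_3'}(v,x)w',w\rangle=\langle w',Y_{W_3}(e^{xL_V(1)}(-x^{-2})^{L_V(0)}v,x^{-1})w\rangle$, if $V$ has a conformal vector, and the adjoints of the coefficients of $Y_{W_3}(v,x)$, $v\in V$, if it has none. Then there is a linear map $$\rho^N:\mathcal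 V_{W_1W_2}^{W_3}\to \mathrm{Hom}_{A^N(V)}\bigl(A^N(W_1)\otimes_{A^N(V)}\Omega_N^0(W_2),\,\Omega_N^0(W_3)\bigr)$$ with $\rho^N(\mathcal Y)\bigl((\mathfrak w+Q^\infty(W_1))\otimes w_2\bigr)=\vartheta_{\mathcal Y}(\mathfrak w)w_2$ for $\mathfrak w\in U^N(W_1)$ and $w_2\in\Omega_N^0(W_2)$ (this formula determines it), and $\rho^N$ is injective. -/

import Mathlib

universe u

namespace VertexAlg

open scoped TensorProduct

noncomputable section

/-! ### Gradings -/

section Graded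

variable {ι : Type*} [DecidableEq ι] {M : Type*} [AddCommGroup M] [Module ℂ M]

/-- The homogeneous component of degree `i` with respect to a direct sum decomposition of `M`. -/
def component (gr : ι → Submodule ℂ M) (h : DirectSum.IsInternal gr) (i : ι) : M →ₗ[ℂ] M :=
  (gr i).subtype ∘ₗ DirectSum.component ℂ ι (fun i => gr i) i ∘ₗ
    ((LinearEquiv.ofBijective (DirectSum.coeLinearMap gr) h).symm : M →ₗ[ℂ] _)

theorem component_mem (gr : ι → Submodule ℂ M) (h : DirectSum.IsInternal gr) (i : ι) (x : M) :
    component gr h i x ∈ gr i := by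
  simp [component]

theorem component_finite (gr : ι → Submodule ℂ M) (h : DirectSum.IsInternal gr) (x : M) :
    {i | component gr h i x ≠ 0}.Finite := by
  classical
  set y := (LinearEquiv.ofBijective (DirectSum.coeLinearMap gr) h).symm x with hy
  refine (DFinsupp.support y).finite_toSet.subset ?_
  intro i hi
  simp only [Finset.mem_coe, DFinsupp.mem_support_toFun]
  intro h0
  apply hi
  simp only [component, LinearMap.comp_apply, LinearEquiv.coe_coe, ← hy, DirectSum.component,
    Submodule.subtype_apply]
  exact congrArg Subtype.val h0

/-- For a `ℂ`-graded space, the weights `h` such that the component of weight `h` is nonzero and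
all components of weights `h - 1, h - 2, …` vanish. If the real parts of the weights are bounded
below, there is exactly one such `h` in every congruence class modulo `ℤ` of weights; it is
the `h ^ μ` of that class `μ`. -/
def minWeights (gr : ℂ → Submodule ℂ M) : Set ℂ :=
  {h | gr h ≠ ⊥ ∧ ∀ m : ℕ, 0 < m → gr (h - m) = ⊥}

/-- The `n`-th level of a `ℂ`-graded space. -/
def level (gr : ℂ → Submodule ℂ M) (n : ℕ) : Submodule ℂ M :=
  ⨆ h ∈ minWeights gr, gr (h + n)

/-- `Ω_N^0`: the sum of the levels `0, …, N`. -/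
def Omega (gr : ℂ → Submodule ℂ M) (N : ℕ) : Submodule ℂ M :=
  ⨆ n ∈ Finset.range (N + 1), level gr n

theorem minWeights_unique (gr : ℂ → Submodule ℂ M) {s : ℂ} {l l' : ℕ}
    (h : s - l ∈ minWeights gr) (h' : s - l' ∈ minWeights gr) : l = l' := by
  rcases lt_trichotomy l l' with hlt | heq | hlt
  · exfalso
    apply h'.1
    have := h.2 (l' - l) (by omega)
    rwa [Nat.cast_sub hlt.le, show s - (l : ℂ) - ((l' : ℂ) - l) = s - l' by ring] at this
  · exact heq
  · exfalso
    apply h.1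
    have := h'.2 (l - l') (by omega)
    rwa [Nat.cast_sub hlt.le, show s - (l' : ℂ) - ((l : ℂ) - l') = s - l by ring] at this

end Graded

/-- A pointwise finite sum of bilinear maps. -/
def sumBilin {ι A B C : Type*} [AddCommGroup A] [Module ℂ A] [AddCommGroup B] [Module ℂ B]
    [AddCommGroup C] [Module ℂ C] (f : ι → A →ₗ[ℂ] B →ₗ[ℂ] C)
    (hf : ∀ a b, {i | f i a b ≠ 0}.Finite) : A →ₗ[ℂ] B →ₗ[ℂ] C :=
  LinearMap.mk₂ ℂ (fun a b => ∑ᶠ i, f i a b)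
    (fun a a' b => by
      simp only [map_add, LinearMap.add_apply]
      exact finsum_add_distrib (hf a b) (hf a' b))
    (fun c a b => by
      simp only [map_smul, LinearMap.smul_apply]
      exact (smul_finsum c _).symm)
    (fun a b b' => by
      simp only [map_add]
      exact finsum_add_distrib (hf a b) (hf a b'))
    (fun c a b => by
      simp only [map_smul]
      exact (smul_finsum c _).symm)

/-! ### Vertex algebras and modules -/

/-- The Jacobi identity, written in components: it is obtained by taking the coefficients of
`x₀ ^ (-r-1) x₁ ^ (-p-1) x₂ ^ (-q-1)` in
`x₀⁻¹ δ((x₁ - x₂)/x₀) Y₃(v, x₁) 𝒴(w₁, x₂) w₂ - x₀⁻¹ δ((x₂ - x₁)/(-x₀)) 𝒴(w₁, x₂) Y₂(v, x₁) w₂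
  = x₂⁻¹ δ((x₁ - x₀)/x₂) 𝒴(Y₁(v, x₀) w₁, x₂) w₂`.
Here `Yᵢ n v` is the coefficient of `x ^ (-n-1)` in `Yᵢ(v, x)`, and likewise for `𝒴`. The indices
of the coefficients of `𝒴` are in `ℤ` or in `ℂ`. -/
def Jacobi {R : Type*} [Ring R] {V W₁ W₂ W₃ : Type*} [AddCommGroup V] [Module ℂ V]
    [AddCommGroup W₁] [Module ℂ W₁] [AddCommGroup W₂] [Module ℂ W₂] [AddCommGroup W₃] [Module ℂ W₃]
    (Y₁ : ℤ → V →ₗ[ℂ] W₁ →ₗ[ℂ] W₁) (Y₂ : ℤ → V →ₗ[ℂ] W₂ →ₗ[ℂ] W₂) (Y₃ : ℤ → V →ₗ[ℂ] W₃ →ₗ[ℂ] W₃)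
    (𝒴 : R → W₁ →ₗ[ℂ] W₂ →ₗ[ℂ] W₃) : Prop :=
  ∀ (v : V) (w₁ : W₁) (w₂ : W₂) (p r : ℤ) (q : R),
    (∑ᶠ i : ℕ, ((-1 : ℂ) ^ i * (Ring.choose r i : ℤ)) •
      (Y₃ (p + r - i) v (𝒴 (q + i) w₁ w₂)
        - ((-1 : ℂ) ^ r) • 𝒴 (q + r - i) w₁ (Y₂ (p + i) v w₂)))
    = ∑ᶠ i : ℕ, ((Ring.choose p i : ℤ) : ℂ) • 𝒴 (p + q - i) (Y₁ (r + i) v w₁) w₂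

/-- A grading-restricted vertex algebra, possibly with a conformal vector: if `conf = none` this is
a grading-restricted vertex algebra, and if `conf = some ω` it is a vertex operator algebra with
conformal vector `ω`. The operator `Y n u` is the coefficient of `x ^ (-n-1)` in `Y_V(u, x)`. -/
structure VertexAlgebra (V : Type u) [AddCommGroup V] [Module ℂ V] where
  /-- the homogeneous subspace of weight `n` -/
  gr : ℤ → Submodule ℂ V
  isInternal : DirectSum.IsInternal gr
  finiteDimensional : ∀ n, FiniteDimensional ℂ (gr n)
  lower_bound : ∃ B : ℤ, ∀ n < B, gr n = ⊥
  Y : ℤ → V →ₗ[ℂ] V →ₗ[ℂ] V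
  /-- the vacuum -/
  one : V
  /-- the operator `L_V(0)` -/
  L0 : Module.End ℂ V
  /-- the operator `L_V(-1)` -/
  Lm1 : Module.End ℂ V
  one_mem : one ∈ gr 0
  truncation : ∀ u v, ∃ K : ℤ, ∀ n, K ≤ n → Y n u v = 0
  identity : ∀ n v, Y n one v = if n = -1 then v else 0
  creation : ∀ v, Y (-1) v one = v ∧ ∀ n : ℤ, 0 ≤ n → Y n v one = 0
  jacobi : Jacobi Y Y Y Y
  L0_grading : ∀ n, ∀ v ∈ gr n, L0 v = (n : ℂ) • v
  L0_bracket : ∀ n u v, L0 (Y n u v) - Y n u (L0 v) = Y n (L0 u) v + (-n - 1 : ℂ) • Y n u v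
  Lm1_derivative : ∀ n u v, Y n (Lm1 u) v = (-n : ℂ) • Y (n - 1) u v
  Lm1_bracket : ∀ n u v, Lm1 (Y n u v) - Y n u (Lm1 v) = (-n : ℂ) • Y (n - 1) u v
  /-- the conformal vector, if there is one -/
  conf : Option V
  conf_L0 : ∀ ω ∈ conf, Y 1 ω = L0
  conf_Lm1 : ∀ ω ∈ conf, Y 0 ω = Lm1
  virasoro : ∀ ω ∈ conf, ∃ c : ℂ, ∀ (m n : ℤ) (v : V),
    Y (m + 1) ω (Y (n + 1) ω v) - Y (n + 1) ω (Y (m + 1) ω v)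
      = (m - n : ℂ) • Y (m + n + 1) ω v
        + if m + n = 0 then (c / 12 * ((m : ℂ) ^ 3 - m)) • v else 0

variable {V : Type u} [AddCommGroup V] [Module ℂ V]

/-- The projection of `V` to the homogeneous subspace of weight `a`. -/
def VertexAlgebra.proj (𝒱 : VertexAlgebra V) (a : ℤ) : V →ₗ[ℂ] V :=
  component 𝒱.gr 𝒱.isInternal a

/-- A lower-bounded generalized module: `W` is the direct sum of the generalized eigenspaces of
`L_W(0)` and the real parts of the eigenvalues are bounded below. If there is a conformal vector,
`L_W(0)` and `L_W(-1)` are given by its vertex operator. -/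
structure LBModule (𝒱 : VertexAlgebra V) (W : Type u) [AddCommGroup W] [Module ℂ W] where
  Y : ℤ → V →ₗ[ℂ] W →ₗ[ℂ] W
  /-- the operator `L_W(0)` -/
  L0 : Module.End ℂ W
  /-- the operator `L_W(-1)` -/
  Lm1 : Module.End ℂ W
  iSup_eigenspace : ⨆ h, L0.maxGenEigenspace h = ⊤
  lower_bound : ∃ B : ℝ, ∀ h : ℂ, L0.maxGenEigenspace h ≠ ⊥ → B ≤ h.re
  truncation : ∀ v w, ∃ K : ℤ, ∀ n, K ≤ n → Y n v w = 0
  identity : ∀ n w, Y n 𝒱.one w = if n = -1 then w else 0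
  jacobi : Jacobi 𝒱.Y Y Y Y
  L0_bracket : ∀ n v w, L0 (Y n v w) - Y n v (L0 w) = Y n (𝒱.L0 v) w + (-n - 1 : ℂ) • Y n v w
  Lm1_derivative : ∀ n v w, Y n (𝒱.Lm1 v) w = (-n : ℂ) • Y (n - 1) v w
  Lm1_bracket : ∀ n v w, Lm1 (Y n v w) - Y n v (Lm1 w) = (-n : ℂ) • Y (n - 1) v w
  L0_Lm1_bracket : ∀ w, L0 (Lm1 w) - Lm1 (L0 w) = Lm1 w
  conf_L0 : ∀ ω ∈ 𝒱.conf, Y 1 ω = L0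
  conf_Lm1 : ∀ ω ∈ 𝒱.conf, Y 0 ω = Lm1

section Module

variable {𝒱 : VertexAlgebra V} {W : Type u} [AddCommGroup W] [Module ℂ W] (M : LBModule 𝒱 W)

namespace LBModule

/-- `W_[h]`, the generalized eigenspace of `L_W(0)` with eigenvalue `h`. -/
def gr (h : ℂ) : Submodule ℂ W := M.L0.maxGenEigenspace h

theorem isInternal : DirectSum.IsInternal M.gr :=
  DirectSum.isInternal_submodule_of_iSupIndep_of_iSup_eq_top
    M.L0.independent_maxGenEigenspace M.iSup_eigenspace

/-- The projection of `W` to `W_[h]`. -/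
def proj (h : ℂ) : W →ₗ[ℂ] W := component M.gr M.isInternal h

/-- `S` is a submodule for the vertex algebra. -/
def IsSubmodule (S : Submodule ℂ W) : Prop :=
  (∀ n v, ∀ w ∈ S, M.Y n v w ∈ S) ∧ (∀ w ∈ S, M.L0 w ∈ S) ∧ (∀ w ∈ S, M.Lm1 w ∈ S)

/-- `W` is generated by the subspace `G`: the only submodule containing `G` is `W`. -/
def GeneratedBy (G : Submodule ℂ W) : Prop :=
  ∀ S : Submodule ℂ W, M.IsSubmodule S → G ≤ S → S = ⊤

/-! ### The graded dual -/

/-- `(W')_[h] = (W_[h])^*`: the functionals on `W` that vanish on `W_[h']` for all `h' ≠ h`. -/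
def dualGr (h : ℂ) : Submodule ℂ (Module.Dual ℂ W) where
  carrier := {f | ∀ h', h' ≠ h → ∀ w ∈ M.gr h', f w = 0}
  zero_mem' := fun _ _ _ _ => rfl
  add_mem' := fun hf hg h' hh w hw => by simp [hf h' hh w hw, hg h' hh w hw]
  smul_mem' := fun c f hf h' hh w hw => by simp [hf h' hh w hw]

/-- The graded dual `W'`, the direct sum of the spaces `(W_[h])^*`. -/
def gradedDual : Submodule ℂ (Module.Dual ℂ W) := ⨆ h, M.dualGr h

/-- The coefficient of `x ^ (-n-1)` in `Y_W(e^{x L_V(1)} (-x^{-2})^{L_V(0)} v, x^{-1})`, where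
`L_V(1)` is the coefficient of `x ^ (-3)` in `Y_V(ω, x)`. -/
def oppositeY (ω : V) (n : ℤ) (v : V) : Module.End ℂ W :=
  ∑ᶠ a : ℤ, ∑ᶠ i : ℕ, ((-1 : ℂ) ^ a / (i.factorial : ℂ)) •
    M.Y (2 * a - n - i - 2) (((𝒱.Y 2 ω) ^ i) (𝒱.proj a v))

/-- The operators on `W'` given by the vertex algebra. If there is a conformal vector, they are the
coefficients of the vertex operators of the contragredient module,
`⟨Y_{W'}(v, x) w', w⟩ = ⟨w', Y_W(e^{x L_V(1)} (-x^{-2})^{L_V(0)} v, x^{-1}) w⟩`.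
If there is none, so that there is no `L_V(1)`, they are the adjoints of the coefficients of the
vertex operators `Y_W(v, x)`. -/
def dualY (n : ℤ) (v : V) (f : Module.Dual ℂ W) : Module.Dual ℂ W :=
  match 𝒱.conf with
  | some ω => f ∘ₗ M.oppositeY ω n v
  | none => f ∘ₗ M.Y n v

/-- `W'` is generated by the subspace `G`: a subspace that contains `G` and is invariant under the
operators on `W'` given by the vertex algebra contains `W'`. -/
def DualGeneratedBy (G : Submodule ℂ (Module.Dual ℂ W)) : Prop :=
  ∀ S : Submodule ℂ (Module.Dual ℂ W), (∀ n v, ∀ f ∈ S, M.dualY n v f ∈ S) → G ≤ S →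
    M.gradedDual ≤ S

end LBModule

end Module

/-! ### Column-finite matrices -/

section Matrices

variable (W : Type u) [AddCommGroup W] [Module ℂ W]

/-- `U^∞(W)`: matrices with entries in `W`, with rows and columns indexed by `ℕ`, such that every
column has only finitely many nonzero entries. -/
def UInf : Submodule ℂ (ℕ → ℕ → W) where
  carrier := {A | ∀ l, {k | A k l ≠ 0}.Finite}
  zero_mem' := fun l => by simp
  add_mem' := fun {A B} hA hB l => ((hA l).union (hB l)).subset fun k hk => by
    by_contra h
    simp only [Set.mem_union, Set.mem_ofPred_eq, not_or, not_not] at h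
    exact hk (by simp [h.1, h.2])
  smul_mem' := fun c A hA l => (hA l).subset fun k hk h => hk (by simp [h])

/-- `U^N(W)`: the `(N+1) × (N+1)` matrices, as a subspace of `U^∞(W)`. -/
def UN (N : ℕ) : Submodule ℂ (UInf W) where
  carrier := {A | ∀ k l, N < k ∨ N < l → A.1 k l = 0}
  zero_mem' := fun _ _ _ => rfl
  add_mem' := fun hA hB k l h => by simp [hA k l h, hB k l h]
  smul_mem' := fun c A hA k l h => by simp [hA k l h]

variable {W}

/-- The `(k, l)`-th entry. -/
def entry (k l : ℕ) : UInf W →ₗ[ℂ] W :=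
  LinearMap.proj l ∘ₗ LinearMap.proj (R := ℂ) (φ := fun _ : ℕ => ℕ → W) k ∘ₗ (UInf W).subtype

@[simp] theorem entry_apply (k l : ℕ) (A : UInf W) : entry k l A = A.1 k l := rfl

end Matrices

section Action

variable {𝒱 : VertexAlgebra V} {W : Type u} [AddCommGroup W] [Module ℂ W] (M : LBModule 𝒱 W)

namespace LBModule

open Classical in
/-- The map `v ↦ ϑ_W([v]_{kl})`: on an element `w` of level `l` it is
`Res_x x^{l-k-1} Y_W(x^{L_V(0)} v, x) w`, and on the other levels it is zero. The elements of
level `l` are those whose components have weights `s` such that `s - l` is a minimal weight. -/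
def thetaEntry (k l : ℕ) : V →ₗ[ℂ] W →ₗ[ℂ] W :=
  sumBilin (fun x : ℤ × ℂ =>
      if x.2 - l ∈ minWeights M.gr then
        (M.Y (x.1 + l - k - 1)).compl₁₂ (𝒱.proj x.1) (M.proj x.2)
      else 0)
    (fun v w => by
      refine ((component_finite 𝒱.gr 𝒱.isInternal v).prod
        (component_finite M.gr M.isInternal w)).subset ?_
      rintro ⟨a, s⟩ h
      simp only [Set.mem_ofPred_eq] at h
      constructor <;> intro h0 <;> apply h <;> split_ifs <;>
        simp_all [VertexAlgebra.proj, LBModule.proj])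

/-- If `ϑ_W([v]_{kl}) w ≠ 0`, then `w` has a nonzero component of level `l`. -/
theorem thetaEntry_ne_zero {k l : ℕ} {v : V} {w : W} (h : M.thetaEntry k l v w ≠ 0) :
    ∃ s, M.proj s w ≠ 0 ∧ s - l ∈ minWeights M.gr := by
  classical
  by_contra hc
  push Not at hc
  apply h
  simp only [thetaEntry, sumBilin, LinearMap.mk₂_apply]
  refine finsum_eq_zero_of_forall_eq_zero fun x => ?_
  split_ifs with hx
  · by_cases h0 : M.proj x.2 w = 0
    · simp [h0]
    · exact absurd hx (hc _ h0)
  · rfl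

theorem levels_finite (w : W) :
    {l : ℕ | ∃ s, M.proj s w ≠ 0 ∧ s - l ∈ minWeights M.gr}.Finite := by
  classical
  have hfin := component_finite M.gr M.isInternal w
  refine (hfin.biUnion (t := fun s => {l : ℕ | s - l ∈ minWeights M.gr}) fun s _ => ?_).subset ?_
  · exact Set.Subsingleton.finite fun l hl l' hl' => minWeights_unique M.gr hl hl'
  · rintro l ⟨s, hs, hl⟩
    simp only [Set.mem_iUnion]
    exact ⟨s, hs, hl⟩

/-- The linear map `ϑ_W : U^∞(V) → End W`. -/
def theta : UInf V →ₗ[ℂ] W →ₗ[ℂ] W :=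
  sumBilin (fun x : ℕ × ℕ => M.thetaEntry x.1 x.2 ∘ₗ entry x.1 x.2)
    (fun A w => by
      refine ((M.levels_finite w).biUnion
        (t := fun l => (fun k => ((k, l) : ℕ × ℕ)) '' {k | A.1 k l ≠ 0})
        fun l _ => (A.2 l).image _).subset ?_
      rintro ⟨k, l⟩ h
      simp only [Set.mem_ofPred_eq, LinearMap.comp_apply, entry_apply] at h
      simp only [Set.mem_iUnion]
      refine ⟨l, M.thetaEntry_ne_zero h, k, ?_, rfl⟩
      intro h0
      apply h
      rw [h0]
      simp)

/-- The coefficient of `x ^ (-n-1)` of the vertex operator of `v ∈ V_(a)` maps `W_[h]` to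
`W_[h + a - n - 1]`. -/
theorem Y_mem_gr {a n : ℤ} {h : ℂ} {v : V} {w : W} (hv : v ∈ 𝒱.gr a) (hw : w ∈ M.gr h) :
    M.Y n v w ∈ M.gr (h + a - n - 1) := by
  have key : ∀ w : W, (M.L0 - (h + a - n - 1) • (1 : Module.End ℂ W)) (M.Y n v w)
      = M.Y n v ((M.L0 - h • (1 : Module.End ℂ W)) w) := by
    intro w
    have h1 := M.L0_bracket n v w
    rw [𝒱.L0_grading a v hv, map_smul, LinearMap.smul_apply, sub_eq_iff_eq_add] at h1
    simp only [LinearMap.sub_apply, LinearMap.smul_apply, Module.End.one_apply, map_sub, map_smul,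
      h1]
    module
  have keypow : ∀ (j : ℕ) (w : W),
      ((M.L0 - (h + a - n - 1) • (1 : Module.End ℂ W)) ^ j) (M.Y n v w)
        = M.Y n v (((M.L0 - h • (1 : Module.End ℂ W)) ^ j) w) := by
    intro j
    induction j with
    | zero => intro w; simp
    | succ j ih => intro w; rw [pow_succ, pow_succ, Module.End.mul_apply, key, ih,
        Module.End.mul_apply]
  unfold gr at hw ⊢
  rw [Module.End.mem_maxGenEigenspace] at hw ⊢
  obtain ⟨j, hj⟩ := hw
  exact ⟨j, by rw [keypow, hj, map_zero]⟩

theorem thetaEntry_mem_level (k l : ℕ) (v : V) (w : W) :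
    M.thetaEntry k l v w ∈ level M.gr k := by
  classical
  simp only [thetaEntry, sumBilin, LinearMap.mk₂_apply]
  refine finsum_induction (· ∈ level M.gr k) (Submodule.zero_mem _)
    (fun _ _ => Submodule.add_mem _) fun x => ?_
  split_ifs with hx
  · refine Submodule.mem_iSup_of_mem (x.2 - l) (Submodule.mem_iSup_of_mem hx ?_)
    have := M.Y_mem_gr (n := x.1 + l - k - 1) (component_mem 𝒱.gr 𝒱.isInternal x.1 v)
      (component_mem M.gr M.isInternal x.2 w)
    rw [show x.2 - (l : ℂ) + k = x.2 + x.1 - ((x.1 + l - k - 1 : ℤ) : ℂ) - 1 by push_cast; ring]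
    exact this
  · exact Submodule.zero_mem _

theorem theta_mem_Omega {N : ℕ} {A : UInf V} (hA : A ∈ UN V N) (w : W) :
    M.theta A w ∈ Omega M.gr N := by
  simp only [theta, sumBilin, LinearMap.mk₂_apply]
  refine finsum_induction (· ∈ Omega M.gr N) (Submodule.zero_mem _)
    (fun _ _ => Submodule.add_mem _) fun x => ?_
  simp only [LinearMap.comp_apply, entry_apply]
  by_cases hx : N < x.1
  · rw [hA x.1 x.2 (Or.inl hx)]
    simp
  · exact Submodule.mem_iSup_of_mem x.1 (Submodule.mem_iSup_of_mem
      (Finset.mem_range.2 (by omega)) (M.thetaEntry_mem_level _ _ _ _))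

end LBModule

/-! ### The algebras `A^∞(V)` and `A^N(V)` -/

/-- `Q^∞(V)`: the intersection of the kernels of `ϑ_W` for all lower-bounded generalized
modules `W`. -/
def QInfV (𝒱 : VertexAlgebra V) : Submodule ℂ (UInf V) :=
  ⨅ (W : Type u) (_ : AddCommGroup W) (_ : Module ℂ W) (M : LBModule 𝒱 W), LinearMap.ker M.theta

/-- The space `A^∞(V) = U^∞(V) / Q^∞(V)`. -/
abbrev AInfV (𝒱 : VertexAlgebra V) : Type u := UInf V ⧸ QInfV 𝒱

/-- The subspace `A^N(V)` of `A^∞(V)`, the image of `U^N(V)`. -/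
def ANV (𝒱 : VertexAlgebra V) (N : ℕ) : Submodule ℂ (AInfV 𝒱) := (UN V N).map (QInfV 𝒱).mkQ

namespace LBModule

/-- The action of `A^∞(V)` on a lower-bounded generalized module, induced by `ϑ_W`. -/
def actInf : AInfV 𝒱 →ₗ[ℂ] W →ₗ[ℂ] W :=
  (QInfV 𝒱).liftQ M.theta
    (iInf_le_of_le W (iInf_le_of_le _ (iInf_le_of_le _ (iInf_le_of_le M le_rfl))))

/-- The action of `A^N(V)` on `Ω_N^0(W)`. -/
def actN (N : ℕ) (α : ANV 𝒱 N) (w : Omega M.gr N) : Omega M.gr N :=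
  ⟨M.actInf α w, by
    obtain ⟨α, A, hA, rfl⟩ := α
    exact M.theta_mem_Omega hA w⟩

end LBModule

end Action

/-! ### Intertwining operators -/

section Intertwining

variable {𝒱 : VertexAlgebra V}
  {W₁ W₂ W₃ : Type u} [AddCommGroup W₁] [Module ℂ W₁] [AddCommGroup W₂] [Module ℂ W₂]
  [AddCommGroup W₃] [Module ℂ W₃]

/-- Logarithmic intertwining operators
`𝒴(w₁, x) w₂ = ∑_{n ∈ ℂ} ∑_{k ∈ ℕ} 𝒴_{n,k}(w₁) w₂ x^{-n-1} (log x)^k`,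
with locally-finite sets of congruence classes of powers. If there is a conformal vector, the
commutator formulas with `L(-1)`, `L(0)` and `L(1)` are special cases of the Jacobi identity;
without one, those with `L(-1)` and `L(0)` are required. -/
structure IsIntertwining (M₁ : LBModule 𝒱 W₁) (M₂ : LBModule 𝒱 W₂) (M₃ : LBModule 𝒱 W₃)
    (𝒴 : ℂ → ℕ → W₁ →ₗ[ℂ] W₂ →ₗ[ℂ] W₃) : Prop where
  log_polynomial : ∀ w₁ w₂ n, ∃ K : ℕ, ∀ k, K ≤ k → 𝒴 n k w₁ w₂ = 0
  truncation : ∀ w₁ w₂ n, ∃ K : ℕ, ∀ m : ℕ, K ≤ m → ∀ k, 𝒴 (n + m) k w₁ w₂ = 0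
  congruence_classes : ∀ w₁ w₂, ∃ F : Set ℂ, F.Finite ∧ ∀ n k, 𝒴 n k w₁ w₂ ≠ 0 →
    ∃ a ∈ F, ∃ j : ℤ, n = a + j
  jacobi : ∀ k, Jacobi M₁.Y M₂.Y M₃.Y (fun n => 𝒴 n k)
  Lm1_derivative : ∀ n k w₁ w₂,
    𝒴 n k (M₁.Lm1 w₁) w₂ = (-n) • 𝒴 (n - 1) k w₁ w₂ + (k + 1 : ℂ) • 𝒴 (n - 1) (k + 1) w₁ w₂
  Lm1_bracket : ∀ n k w₁ w₂,
    M₃.Lm1 (𝒴 n k w₁ w₂) - 𝒴 n k w₁ (M₂.Lm1 w₂) = 𝒴 n k (M₁.Lm1 w₁) w₂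
  L0_bracket : ∀ n k w₁ w₂,
    M₃.L0 (𝒴 n k w₁ w₂) - 𝒴 n k w₁ (M₂.L0 w₂)
      = 𝒴 n k (M₁.L0 w₁) w₂ + 𝒴 (n + 1) k (M₁.Lm1 w₁) w₂

section Closure

variable {M₁ : LBModule 𝒱 W₁} {M₂ : LBModule 𝒱 W₂} {M₃ : LBModule 𝒱 W₃}

/-- The sum on the left-hand side of the Jacobi identity is finite. -/
theorem jacobi_left_finite {𝒴 : ℂ → ℕ → W₁ →ₗ[ℂ] W₂ →ₗ[ℂ] W₃}
    (h : ∀ w₁ w₂ n, ∃ K : ℕ, ∀ m : ℕ, K ≤ m → ∀ k, 𝒴 (n + m) k w₁ w₂ = 0)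
    (k : ℕ) (v : V) (w₁ : W₁) (w₂ : W₂) (p r : ℤ) (q : ℂ) :
    (Function.support fun i : ℕ => ((-1 : ℂ) ^ i * (Ring.choose r i : ℤ)) •
      (M₃.Y (p + r - i) v (𝒴 (q + i) k w₁ w₂)
        - ((-1 : ℂ) ^ r) • 𝒴 (q + r - i) k w₁ (M₂.Y (p + i) v w₂))).Finite := by
  obtain ⟨K, hK⟩ := h w₁ w₂ q
  obtain ⟨L, hL⟩ := M₂.truncation v w₂
  refine (Set.finite_lt_nat (K + (L - p).toNat)).subset fun i hi => ?_
  by_contra hc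
  simp only [Set.mem_ofPred_eq, not_lt] at hc
  apply hi
  have h1 := hK i (by omega) k
  have h2 := hL (p + i) (by omega)
  simp [h1, h2]

/-- The sum on the right-hand side of the Jacobi identity is finite. -/
theorem jacobi_right_finite (𝒴 : ℂ → ℕ → W₁ →ₗ[ℂ] W₂ →ₗ[ℂ] W₃)
    (k : ℕ) (v : V) (w₁ : W₁) (w₂ : W₂) (p r : ℤ) (q : ℂ) :
    (Function.support fun i : ℕ => ((Ring.choose p i : ℤ) : ℂ) •
      𝒴 (p + q - i) k (M₁.Y (r + i) v w₁) w₂).Finite := by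
  obtain ⟨L, hL⟩ := M₁.truncation v w₁
  refine (Set.finite_lt_nat ((L - r).toNat)).subset fun i hi => ?_
  by_contra hc
  simp only [Set.mem_ofPred_eq, not_lt] at hc
  apply hi
  have h2 := hL (r + i) (by omega)
  simp [h2]

theorem isIntertwining_zero : IsIntertwining M₁ M₂ M₃ 0 where
  log_polynomial := fun _ _ _ => ⟨0, fun _ _ => rfl⟩
  truncation := fun _ _ _ => ⟨0, fun _ _ _ => rfl⟩
  congruence_classes := fun _ _ => ⟨∅, Set.finite_empty, fun _ _ h => absurd rfl h⟩
  jacobi := fun k v w₁ w₂ p r q => by simp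
  Lm1_derivative := fun _ _ _ _ => by simp
  Lm1_bracket := fun _ _ _ _ => by simp
  L0_bracket := fun _ _ _ _ => by simp

theorem IsIntertwining.add {𝒴 𝒵 : ℂ → ℕ → W₁ →ₗ[ℂ] W₂ →ₗ[ℂ] W₃}
    (hY : IsIntertwining M₁ M₂ M₃ 𝒴) (hZ : IsIntertwining M₁ M₂ M₃ 𝒵) :
    IsIntertwining M₁ M₂ M₃ (𝒴 + 𝒵) where
  log_polynomial := fun w₁ w₂ n => by
    obtain ⟨K, hK⟩ := hY.log_polynomial w₁ w₂ n
    obtain ⟨L, hL⟩ := hZ.log_polynomial w₁ w₂ n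
    exact ⟨max K L, fun k hk => by simp [hK k (by omega), hL k (by omega)]⟩
  truncation := fun w₁ w₂ n => by
    obtain ⟨K, hK⟩ := hY.truncation w₁ w₂ n
    obtain ⟨L, hL⟩ := hZ.truncation w₁ w₂ n
    exact ⟨max K L, fun m hm k => by simp [hK m (by omega) k, hL m (by omega) k]⟩
  congruence_classes := fun w₁ w₂ => by
    obtain ⟨F, hF, hF'⟩ := hY.congruence_classes w₁ w₂
    obtain ⟨G, hG, hG'⟩ := hZ.congruence_classes w₁ w₂
    refine ⟨F ∪ G, hF.union hG, fun n k h => ?_⟩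
    by_cases h1 : 𝒴 n k w₁ w₂ = 0
    · have h2 : 𝒵 n k w₁ w₂ ≠ 0 := fun h2 => h (by simp [h1, h2])
      obtain ⟨a, ha, j, hj⟩ := hG' n k h2
      exact ⟨a, Or.inr ha, j, hj⟩
    · obtain ⟨a, ha, j, hj⟩ := hF' n k h1
      exact ⟨a, Or.inl ha, j, hj⟩
  jacobi := fun k v w₁ w₂ p r q => by
    have e1 := hY.jacobi k v w₁ w₂ p r q
    have e2 := hZ.jacobi k v w₁ w₂ p r q
    have e3 := congrArg₂ (· + ·) e1 e2
    simp only at e3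
    rw [← finsum_add_distrib (jacobi_left_finite hY.truncation k v w₁ w₂ p r q)
      (jacobi_left_finite hZ.truncation k v w₁ w₂ p r q),
      ← finsum_add_distrib (jacobi_right_finite 𝒴 k v w₁ w₂ p r q)
      (jacobi_right_finite 𝒵 k v w₁ w₂ p r q)] at e3
    refine Eq.trans (finsum_congr fun i => ?_) (e3.trans (finsum_congr fun i => ?_))
    · simp only [Pi.add_apply, LinearMap.add_apply, map_add]
      module
    · simp only [Pi.add_apply, LinearMap.add_apply]
      module
  Lm1_derivative := fun n k w₁ w₂ => by
    simp only [Pi.add_apply, LinearMap.add_apply, hY.Lm1_derivative, hZ.Lm1_derivative]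
    module
  Lm1_bracket := fun n k w₁ w₂ => by
    simp only [Pi.add_apply, LinearMap.add_apply, map_add, ← hY.Lm1_bracket, ← hZ.Lm1_bracket]
    module
  L0_bracket := fun n k w₁ w₂ => by
    have e1 := hY.L0_bracket n k w₁ w₂
    have e2 := hZ.L0_bracket n k w₁ w₂
    simp only [Pi.add_apply, LinearMap.add_apply, map_add]
    rw [add_add_add_comm, ← e1, ← e2]
    module

theorem IsIntertwining.smul {𝒴 : ℂ → ℕ → W₁ →ₗ[ℂ] W₂ →ₗ[ℂ] W₃} (c : ℂ)
    (hY : IsIntertwining M₁ M₂ M₃ 𝒴) : IsIntertwining M₁ M₂ M₃ (c • 𝒴) where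
  log_polynomial := fun w₁ w₂ n => by
    obtain ⟨K, hK⟩ := hY.log_polynomial w₁ w₂ n
    exact ⟨K, fun k hk => by simp [hK k hk]⟩
  truncation := fun w₁ w₂ n => by
    obtain ⟨K, hK⟩ := hY.truncation w₁ w₂ n
    exact ⟨K, fun m hm k => by simp [hK m hm k]⟩
  congruence_classes := fun w₁ w₂ => by
    obtain ⟨F, hF, hF'⟩ := hY.congruence_classes w₁ w₂
    exact ⟨F, hF, fun n k h => hF' n k fun h0 => h (by simp [h0])⟩
  jacobi := fun k v w₁ w₂ p r q => by
    have e1 := congrArg (c • ·) (hY.jacobi k v w₁ w₂ p r q)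
    simp only [smul_finsum] at e1
    refine Eq.trans (finsum_congr fun i => ?_) (e1.trans (finsum_congr fun i => ?_))
    · simp only [Pi.smul_apply, LinearMap.smul_apply, map_smul]
      module
    · simp only [Pi.smul_apply, LinearMap.smul_apply]
      module
  Lm1_derivative := fun n k w₁ w₂ => by
    simp only [Pi.smul_apply, LinearMap.smul_apply, hY.Lm1_derivative]
    module
  Lm1_bracket := fun n k w₁ w₂ => by
    simp only [Pi.smul_apply, LinearMap.smul_apply, map_smul, ← hY.Lm1_bracket]
    module
  L0_bracket := fun n k w₁ w₂ => by
    have e1 := congrArg (c • ·) (hY.L0_bracket n k w₁ w₂)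
    simp only [Pi.smul_apply, LinearMap.smul_apply, map_smul]
    simp only [smul_add, smul_sub] at e1
    exact e1

end Closure

/-- The space of intertwining operators of type `(W₃ over W₁ W₂)`. -/
def Intertwiners (M₁ : LBModule 𝒱 W₁) (M₂ : LBModule 𝒱 W₂) (M₃ : LBModule 𝒱 W₃) :
    Submodule ℂ (ℂ → ℕ → W₁ →ₗ[ℂ] W₂ →ₗ[ℂ] W₃) where
  carrier := {𝒴 | IsIntertwining M₁ M₂ M₃ 𝒴}
  zero_mem' := isIntertwining_zero
  add_mem' := fun h h' => h.add h'
  smul_mem' := fun c _ h => h.smul c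

namespace Intertwiners

variable {M₁ : LBModule 𝒱 W₁} {M₂ : LBModule 𝒱 W₂} {M₃ : LBModule 𝒱 W₃}
  (𝒴 : Intertwiners M₁ M₂ M₃)

open Classical in
/-- The map `w₁ ↦ ϑ_𝒴([w₁]_{kl})`. For `w₁` of weight `b` and `w₂` of weight `s = h₂ + l`, where
`h₂` is a minimal weight of `W₂`, it is the sum over all the minimal weights `h₃ = t - k` of `W₃` of
`Res_x x^{h₂ - h₃ + l - k - 1} 𝒴⁰(x^b w₁, x) w₂`, where `𝒴⁰` is the coefficient of `(log x)^0`. It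
is zero on the elements of `W₂` whose levels are not `l`. -/
def thetaEntry (k l : ℕ) : W₁ →ₗ[ℂ] W₂ →ₗ[ℂ] W₃ :=
  sumBilin (fun x : (ℂ × ℂ) × ℂ =>
      if x.1.2 - l ∈ minWeights M₂.gr ∧ x.2 - k ∈ minWeights M₃.gr then
        (𝒴.1 (x.1.1 + x.1.2 - x.2 - 1) 0).compl₁₂ (M₁.proj x.1.1) (M₂.proj x.1.2)
      else 0)
    (fun w₁ w₂ => by
      have hfin := (component_finite M₁.gr M₁.isInternal w₁).prod
        (component_finite M₂.gr M₂.isInternal w₂)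
      refine (hfin.biUnion (t := fun y => (fun t => ((y, t) : (ℂ × ℂ) × ℂ)) ''
        {t : ℂ | t - k ∈ minWeights M₃.gr ∧
          𝒴.1 (y.1 + y.2 - t - 1) 0 (M₁.proj y.1 w₁) (M₂.proj y.2 w₂) ≠ 0})
        fun y _ => Set.Finite.image _ ?_).subset ?_
      · obtain ⟨F, hF, hF'⟩ := 𝒴.2.congruence_classes (M₁.proj y.1 w₁) (M₂.proj y.2 w₂)
        refine (hF.biUnion (t := fun a => {t : ℂ | t - k ∈ minWeights M₃.gr ∧
          ∃ j : ℤ, y.1 + y.2 - t - 1 = a + j}) fun a _ =>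
            Set.Subsingleton.finite ?_).subset ?_
        · have key : ∀ t t' : ℂ, t - k ∈ minWeights M₃.gr → t' - k ∈ minWeights M₃.gr →
              ∀ j j' : ℤ, j ≤ j' → y.1 + y.2 - t - 1 = a + j → y.1 + y.2 - t' - 1 = a + j' →
              t = t' := by
            intro t t' ht ht' j j' hjj hj hj'
            obtain ⟨d, rfl⟩ := Int.le.dest hjj
            have e : t' = t - d := by
              push_cast at hj'
              linear_combination hj - hj'
            rcases Nat.eq_zero_or_pos d with h0 | h0
            · simp [e, h0]
            · refine absurd (ht.2 d h0) ?_
              have := ht'.1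
              rwa [e, show t - (d : ℂ) - k = t - k - d by ring] at this
          rintro t ⟨ht, j, hj⟩ t' ⟨ht', j', hj'⟩
          rcases le_total j j' with hjj | hjj
          · exact key t t' ht ht' j j' hjj hj hj'
          · exact (key t' t ht' ht j' j hjj hj' hj).symm
        · rintro t ⟨ht, hne⟩
          obtain ⟨a, ha, j, hj⟩ := hF' _ _ hne
          simp only [Set.mem_iUnion]
          exact ⟨a, ha, ht, j, hj⟩
      · rintro ⟨⟨b, s⟩, t⟩ h
        simp only [Set.mem_ofPred_eq] at h
        simp only [Set.mem_iUnion]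
        split_ifs at h with hc
        · refine ⟨(b, s), ⟨?_, ?_⟩, t, ⟨hc.2, h⟩, rfl⟩
          · intro h0
            apply h
            have h0' : M₁.proj b w₁ = 0 := h0
            simp [h0']
          · intro h0
            apply h
            have h0' : M₂.proj s w₂ = 0 := h0
            simp [h0']
        · exact absurd rfl h)

theorem thetaEntry_ne_zero {k l : ℕ} {w₁ : W₁} {w₂ : W₂} (h : thetaEntry 𝒴 k l w₁ w₂ ≠ 0) :
    ∃ s, M₂.proj s w₂ ≠ 0 ∧ s - l ∈ minWeights M₂.gr := by
  classical
  by_contra hc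
  push Not at hc
  apply h
  simp only [thetaEntry, sumBilin, LinearMap.mk₂_apply]
  refine finsum_eq_zero_of_forall_eq_zero fun x => ?_
  split_ifs with hx
  · by_cases h0 : M₂.proj x.1.2 w₂ = 0
    · simp [h0]
    · exact absurd hx.1 (hc _ h0)
  · rfl

/-- The linear map `ϑ_𝒴 : U^∞(W₁) → Hom(W₂, W₃)`. -/
def theta : UInf W₁ →ₗ[ℂ] W₂ →ₗ[ℂ] W₃ :=
  sumBilin (fun x : ℕ × ℕ => thetaEntry 𝒴 x.1 x.2 ∘ₗ entry x.1 x.2)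
    (fun A w => by
      refine ((M₂.levels_finite w).biUnion
        (t := fun l => (fun k => ((k, l) : ℕ × ℕ)) '' {k | A.1 k l ≠ 0})
        fun l _ => (A.2 l).image _).subset ?_
      rintro ⟨k, l⟩ h
      simp only [Set.mem_ofPred_eq, LinearMap.comp_apply, entry_apply] at h
      simp only [Set.mem_iUnion]
      refine ⟨l, thetaEntry_ne_zero 𝒴 h, k, ?_, rfl⟩
      intro h0
      apply h
      rw [h0]
      simp)

end Intertwiners

end Intertwining

/-! ### The bimodules `A^∞(W)` and `A^N(W)` -/

section Bimodule

variable {𝒱 : VertexAlgebra V} {W : Type u} [AddCommGroup W] [Module ℂ W] (M : LBModule 𝒱 W)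

/-- `Q^∞(W)`: the intersection of the kernels of `ϑ_𝒴` for all lower-bounded generalized
modules `W₂` and `W₃` and all intertwining operators `𝒴` of type `(W₃ over W W₂)`. -/
def QInf : Submodule ℂ (UInf W) :=
  ⨅ (W₂ : Type u) (_ : AddCommGroup W₂) (_ : Module ℂ W₂) (M₂ : LBModule 𝒱 W₂)
    (W₃ : Type u) (_ : AddCommGroup W₃) (_ : Module ℂ W₃) (M₃ : LBModule 𝒱 W₃)
    (𝒴 : Intertwiners M M₂ M₃), LinearMap.ker (Intertwiners.theta 𝒴)

/-- The space `A^∞(W) = U^∞(W) / Q^∞(W)`. -/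
def AInf : Type u := UInf W ⧸ QInf M

instance : AddCommGroup (AInf M) := inferInstanceAs (AddCommGroup (UInf W ⧸ QInf M))

instance : Module ℂ (AInf M) := inferInstanceAs (Module ℂ (UInf W ⧸ QInf M))

/-- The projection from `U^∞(W)` to `A^∞(W)`. -/
def mkInf : UInf W →ₗ[ℂ] AInf M := (QInf M).mkQ

/-- The subspace `A^N(W)` of `A^∞(W)`, the image of `U^N(W)`. -/
def AN (N : ℕ) : Submodule ℂ (AInf M) := (UN W N).map (mkInf M)

/-- The entry of `[v]_{kn} ⋄ [w]_{nl}`,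
`∑_{m=0}^n binom(-k+n-l-1, m) Res_x x^{-k+n-l-m-1} (1+x)^l Y_W((1+x)^{L_V(0)} v, x) w`. -/
def leftEntry (k n l : ℕ) (v : V) (w : W) : W :=
  ∑ m ∈ Finset.range (n + 1), ((Ring.choose (-k + n - l - 1 : ℤ) m : ℤ) : ℂ) •
    ∑ᶠ a : ℤ, ∑ᶠ i : ℕ, ((Ring.choose (l + a) i : ℤ) : ℂ) •
      M.Y (-k + n - l - m - 1 + i) (𝒱.proj a v) w

/-- The entry of `[w]_{kn} ⋄ [v]_{nl}`,
`∑_{m=0}^n binom(-k+n-l-1, m) Res_x x^{-k+n-l-m-1} (1+x)^k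
  Y_W((1+x)^{-L_V(0)} v, -x (1+x)^{-1}) w`. The `i`-th summand below comes from the coefficient
with index `j = -k+n-l-m-1+i` of the vertex operator, which is multiplied by
`(-1)^(j+1) x^(-j-1) (1+x)^(j+1)`. -/
def rightEntry (k n l : ℕ) (w : W) (v : V) : W :=
  ∑ m ∈ Finset.range (n + 1), ((Ring.choose (-k + n - l - 1 : ℤ) m : ℤ) : ℂ) •
    ∑ᶠ a : ℤ, ∑ᶠ i : ℕ, ((-1 : ℂ) ^ (-k + n - l - m - 1 + i + 1 : ℤ) *
        (Ring.choose (k - a + (-k + n - l - m - 1 + i) + 1) i : ℤ)) •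
      M.Y (-k + n - l - m - 1 + i) (𝒱.proj a v) w

theorem leftEntry_zero_left (k n l : ℕ) (w : W) : leftEntry M k n l 0 w = 0 := by
  simp [leftEntry]

theorem leftEntry_zero_right (k n l : ℕ) (v : V) : leftEntry M k n l v 0 = 0 := by
  simp [leftEntry]

theorem rightEntry_zero_left (k n l : ℕ) (v : V) : rightEntry M k n l 0 v = 0 := by
  simp [rightEntry]

theorem rightEntry_zero_right (k n l : ℕ) (w : W) : rightEntry M k n l w 0 = 0 := by
  simp [rightEntry]

/-- A product of column-finite matrices is column-finite. -/
theorem mul_mem_UInf {X Z T : Type u} [AddCommGroup X] [Module ℂ X] [AddCommGroup Z] [Module ℂ Z]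
    [AddCommGroup T] [Module ℂ T] (f : ℕ → ℕ → ℕ → X → Z → T)
    (hl : ∀ k n l z, f k n l 0 z = 0) (hr : ∀ k n l x, f k n l x 0 = 0)
    (A : UInf X) (B : UInf Z) :
    (fun k l => ∑ᶠ n : ℕ, f k n l (A.1 k n) (B.1 n l)) ∈ UInf T := by
  intro l
  refine ((B.2 l).biUnion (t := fun n => {k | A.1 k n ≠ 0}) fun n _ => A.2 n).subset ?_
  intro k hk
  by_contra hc
  apply hk
  refine finsum_eq_zero_of_forall_eq_zero fun n => ?_
  simp only [Set.mem_iUnion, Set.mem_ofPred_eq, exists_prop, not_exists, not_and, not_not] at hc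
  by_cases h0 : B.1 n l = 0
  · rw [h0, hr]
  · rw [hc n h0, hl]

/-- The left action of `U^∞(V)` on `U^∞(W)`. -/
def leftMul (A : UInf V) (B : UInf W) : UInf W :=
  ⟨fun k l => ∑ᶠ n : ℕ, leftEntry M k n l (A.1 k n) (B.1 n l),
    mul_mem_UInf _ (leftEntry_zero_left M) (leftEntry_zero_right M) A B⟩

/-- The right action of `U^∞(V)` on `U^∞(W)`. -/
def rightMul (B : UInf W) (A : UInf V) : UInf W :=
  ⟨fun k l => ∑ᶠ n : ℕ, rightEntry M k n l (B.1 k n) (A.1 n l),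
    mul_mem_UInf _ (rightEntry_zero_left M) (rightEntry_zero_right M) B A⟩

/-- The graph of the left action of `A^N(V)` on `A^N(W)`: `γ = α ⋄ β`, that is, `α`, `β` and `γ`
are the classes of matrices `A`, `B` and `A ⋄ B`, where `A` and `B` are in `U^N(V)` and `U^N(W)`. -/
def IsLeftProduct (N : ℕ) (α : ANV 𝒱 N) (β γ : AN M N) : Prop :=
  ∃ A ∈ UN V N, ∃ B ∈ UN W N, (α : AInfV 𝒱) = (QInfV 𝒱).mkQ A ∧
    (β : AInf M) = mkInf M B ∧ (γ : AInf M) = mkInf M (leftMul M A B)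

/-- The graph of the right action of `A^N(V)` on `A^N(W)`: `γ = β ⋄ α`. -/
def IsRightProduct (N : ℕ) (β : AN M N) (α : ANV 𝒱 N) (γ : AN M N) : Prop :=
  ∃ B ∈ UN W N, ∃ A ∈ UN V N, (β : AInf M) = mkInf M B ∧
    (α : AInfV 𝒱) = (QInfV 𝒱).mkQ A ∧ (γ : AInf M) = mkInf M (rightMul M B A)

end Bimodule

/-! ### Tensor product and homomorphisms over `A^N(V)` -/

section Hom

variable {𝒱 : VertexAlgebra V}
  {W₁ W₂ W₃ : Type u} [AddCommGroup W₁] [Module ℂ W₁] [AddCommGroup W₂] [Module ℂ W₂]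
  [AddCommGroup W₃] [Module ℂ W₃]

/-- The subspace of `A^N(W₁) ⊗_ℂ Ω_N^0(W₂)` spanned by the elements
`(β ⋄ α) ⊗ w₂ - β ⊗ (α w₂)` for `α ∈ A^N(V)`, `β ∈ A^N(W₁)` and `w₂ ∈ Ω_N^0(W₂)`. -/
def balancedRel (M₁ : LBModule 𝒱 W₁) (M₂ : LBModule 𝒱 W₂) (N : ℕ) :
    Submodule ℂ (AN M₁ N ⊗[ℂ] Omega M₂.gr N) :=
  Submodule.span ℂ {z | ∃ (β γ : AN M₁ N) (α : ANV 𝒱 N) (w₂ : Omega M₂.gr N),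
    IsRightProduct M₁ N β α γ ∧ z = γ ⊗ₜ[ℂ] w₂ - β ⊗ₜ[ℂ] M₂.actN N α w₂}

/-- The tensor product of `A^N(W₁)` and `Ω_N^0(W₂)` over `A^N(V)`. -/
abbrev TensorN (M₁ : LBModule 𝒱 W₁) (M₂ : LBModule 𝒱 W₂) (N : ℕ) : Type u :=
  (AN M₁ N ⊗[ℂ] Omega M₂.gr N) ⧸ balancedRel M₁ M₂ N

/-- The element `β ⊗ w₂` of the tensor product over `A^N(V)`. -/
def tmulN (M₁ : LBModule 𝒱 W₁) (M₂ : LBModule 𝒱 W₂) (N : ℕ) (β : AN M₁ N)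
    (w₂ : Omega M₂.gr N) : TensorN M₁ M₂ N :=
  (balancedRel M₁ M₂ N).mkQ (β ⊗ₜ[ℂ] w₂)

/-- The space of `A^N(V)`-module maps from the tensor product of `A^N(W₁)` and `Ω_N^0(W₂)` over
`A^N(V)` to `Ω_N^0(W₃)`: the linear maps `f` such that `f((α ⋄ β) ⊗ w₂) = α f(β ⊗ w₂)`. -/
def HomN (M₁ : LBModule 𝒱 W₁) (M₂ : LBModule 𝒱 W₂) (M₃ : LBModule 𝒱 W₃) (N : ℕ) :
    Submodule ℂ (TensorN M₁ M₂ N →ₗ[ℂ] Omega M₃.gr N) where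
  carrier := {f | ∀ (α : ANV 𝒱 N) (β γ : AN M₁ N) (w₂ : Omega M₂.gr N),
    IsLeftProduct M₁ N α β γ → f (tmulN M₁ M₂ N γ w₂) = M₃.actN N α (f (tmulN M₁ M₂ N β w₂))}
  zero_mem' := fun α β γ w₂ _ => by
    apply Subtype.ext
    simp [LBModule.actN]
  add_mem' := fun {f g} hf hg α β γ w₂ h => by
    apply Subtype.ext
    simp [LBModule.actN, hf α β γ w₂ h, hg α β γ w₂ h]
  smul_mem' := fun c f hf α β γ w₂ h => by
    apply Subtype.ext
    simp [LBModule.actN, hf α β γ w₂ h]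

/-- The class in `A^N(W)` of an element of `U^N(W)`. -/
def classN (M₁ : LBModule 𝒱 W₁) (N : ℕ) (B : UN W₁ N) : AN M₁ N :=
  ⟨mkInf M₁ B, Submodule.mem_map_of_mem B.2⟩

end Hom

end

end VertexAlg

open VertexAlg

/-! The map $\rho^N$ exists because $\vartheta_{\mathcal Y}$ turns $\diamond$ into composition: with
$\vartheta_{W_3}$ on the left (`thetaEntry_leftEntry`) and with $\vartheta_{W_2}$ on the right
(`thetaEntry_rightEntry`). By `IsIntertwining.mem_gr` each coefficient of $\mathcal Y$ shifts
weights by a fixed amount, so on homogeneous vectors a single weight component of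
$\vartheta_{\mathcal Y}([w_1]_{kl})w_2$ is one coefficient of $\mathcal Y^0$. The indices in the
Jacobi identity can then be chosen so that one of its two products passes through a space below a
minimal weight and disappears. What remains is a sum of products $Z_j$, where $Z_j=0$ for $j>n$,
again by minimality. The sum over $m\le n$ in the definition of $\diamond$ collapses it to $Z_0$,
because $\sum_m\binom cm x^m(1-x)^{c-m}=1$.

For injectivity, suppose that $\vartheta_{\mathcal Y}$ vanishes on $U^N(W_1)$ and $\Omega_N^0(W_2)$.
Homogeneity gives $\langle f,\mathcal Y^0(w_1,x)w_2\rangle=0$ for all $w_1$, all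
$w_2\in\Omega_N^0(W_2)$ and all $f\in\Omega_N^0(W_3')$. The vanishing then spreads in two stages.
With $f$ still confined to $\Omega_N^0(W_3')$, the good $w_2$ form a submodule
(`isSubmodule_omegaKernel`): the Jacobi identity can be arranged so that only weight-raising
operators act on $W_3$, and their transposes preserve $\Omega_N^0(W_3')$. So every $w_2\in W_2$ is
good. Next, the functionals that kill all of $\mathcal Y^0$ are stable under the operators on $W_3'$
by the commutator formula (`dualY_mem_annihilator`), so they include all of $W_3'$, which separates
points. Finally $\mathcal Y^0=0$ forces $\mathcal Y=0$ by the $L(-1)$-derivative property. -/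

namespace VertexAlg

open scoped TensorProduct

/-! ### Gradings and pointwise finite sums. -/

section Graded

variable {ι : Type*} [DecidableEq ι] {M : Type*} [AddCommGroup M] [Module ℂ M]
  {gr : ι → Submodule ℂ M}

theorem component_of_mem (h : DirectSum.IsInternal gr) {i : ι} {x : M} (hx : x ∈ gr i) :
    component gr h i x = x := by
  have : (LinearEquiv.ofBijective (DirectSum.coeLinearMap gr) h).symm x
      = DirectSum.lof ℂ ι (fun i => gr i) i ⟨x, hx⟩ :=
    (LinearEquiv.symm_apply_eq _).2 (DirectSum.coeLinearMap_lof gr i ⟨x, hx⟩).symm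
  simp [component, this, DirectSum.component.lof_self]

theorem component_of_mem_ne (h : DirectSum.IsInternal gr) {i j : ι} (hij : i ≠ j) {x : M}
    (hx : x ∈ gr i) : component gr h j x = 0 := by
  have : (LinearEquiv.ofBijective (DirectSum.coeLinearMap gr) h).symm x
      = DirectSum.lof ℂ ι (fun i => gr i) i ⟨x, hx⟩ :=
    (LinearEquiv.symm_apply_eq _).2 (DirectSum.coeLinearMap_lof gr i ⟨x, hx⟩).symm
  simp [component, this, DirectSum.component.of, hij]

theorem ext_of_isInternal (h : DirectSum.IsInternal gr) {N : Type*} [AddCommGroup N] [Module ℂ N]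
    {f g : M →ₗ[ℂ] N} (hfg : ∀ i, ∀ x ∈ gr i, f x = g x) : f = g := by
  refine LinearMap.ext fun x => ?_
  have hx : x ∈ ⨆ i, gr i := by
    rw [h.submodule_iSup_eq_top]
    trivial
  induction hx using Submodule.iSup_induction' with
  | mem i x hx => exact hfg i x hx
  | zero => simp
  | add x y _ _ hx hy => simp [hx, hy]

theorem ext_component (h : DirectSum.IsInternal gr) {x y : M}
    (hxy : ∀ i, component gr h i x = component gr h i y) : x = y := by
  apply (LinearEquiv.ofBijective (DirectSum.coeLinearMap gr) h).symm.injective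
  refine DFinsupp.ext fun i => Subtype.ext ?_
  exact hxy i

end Graded

section SumBilin

variable {ι A B C D : Type*} [AddCommGroup A] [Module ℂ A] [AddCommGroup B] [Module ℂ B]
    [AddCommGroup C] [Module ℂ C] [AddCommGroup D] [Module ℂ D]

theorem map_sumBilin (g : C →ₗ[ℂ] D) (f : ι → A →ₗ[ℂ] B →ₗ[ℂ] C)
    (hf : ∀ a b, {i | f i a b ≠ 0}.Finite) (a : A) (b : B) :
    g (sumBilin f hf a b) = ∑ᶠ i, g (f i a b) :=
  g.toAddMonoidHom.map_finsum (hf a b)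

theorem sumBilin_eq_single (f : ι → A →ₗ[ℂ] B →ₗ[ℂ] C) (hf : ∀ a b, {i | f i a b ≠ 0}.Finite)
    (a : A) (b : B) (i : ι) (h : ∀ j, j ≠ i → f j a b = 0) :
    sumBilin f hf a b = f i a b :=
  finsum_eq_single _ i h

end SumBilin

/-! ### Binomial identities behind the product $\diamond$. -/

section Binomial

/-- The coefficients of `(1 - x)^j` in terms of the expansions of `(1 - x)^(c-m)`. -/
theorem sum_choose_mul_choose (c : ℤ) (j : ℕ) :
    ∑ m ∈ Finset.range (j + 1), Ring.choose c m * ((-1) ^ (j - m) * Ring.choose (c - m) (j - m))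
      = if j = 0 then 1 else 0 := by
  -- Choosing a subset of a subset takes $\binom cj$ out of the sum and leaves the alternating sum
  -- of row $j$ of Pascal's triangle.
  have h : ∀ m ∈ Finset.range (j + 1),
      Ring.choose c m * ((-1) ^ (j - m) * Ring.choose (c - m) (j - m))
        = Ring.choose c j * ((-1) ^ (j - m) * (j.choose (j - m) : ℤ)) := by
    intro m hm
    have hmj : m ≤ j := Nat.lt_succ_iff.1 (Finset.mem_range.1 hm)
    have := Ring.choose_smul_choose c hmj
    rw [nsmul_eq_mul] at this
    rw [Nat.choose_symm hmj]
    linear_combination -(-1) ^ (j - m) * this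
  rw [Finset.sum_congr rfl h, ← Finset.mul_sum,
    Finset.sum_flip (fun m => (-1) ^ m * (j.choose m : ℤ)),
    Int.alternating_sum_range_choose]
  split_ifs with hj
  · simp [hj]
  · simp

/-- The expansion $\sum_m\binom cm x^m(1-x)^{c-m}=1$ with $x^j$ replaced by $Z_j$. Cutting the sum
at $m=n$ is harmless, as the terms with larger $m$ only involve $Z_j$ with $j>n$. -/
theorem sum_choose_smul_truncated {M : Type*} [AddCommGroup M] [Module ℂ M] (c : ℤ) (n : ℕ)
    (Z : ℕ → M) (hZ : ∀ j, n < j → Z j = 0) :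
    ∑ m ∈ Finset.range (n + 1), ((Ring.choose c m : ℤ) : ℂ) •
      ∑ᶠ i : ℕ, ((-1 : ℂ) ^ i * (Ring.choose (c - m) i : ℤ)) • Z (m + i) = Z 0 := by
  -- Reindexing by the total degree $j=m+i\le n$ makes the double sum triangular, so that the
  -- coefficient of each $Z_j$ can be collected.
  have h1 : ∀ m ∈ Finset.range (n + 1), ((Ring.choose c m : ℤ) : ℂ) •
      ∑ᶠ i : ℕ, ((-1 : ℂ) ^ i * (Ring.choose (c - m) i : ℤ)) • Z (m + i)
      = ∑ j ∈ Finset.range (n + 1), if m ≤ j then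
        ((Ring.choose c m * ((-1) ^ (j - m) * Ring.choose (c - m) (j - m)) : ℤ) : ℂ) • Z j
        else 0 := by
    intro m hm
    rw [finsum_eq_sum_of_support_subset (s := Finset.range (n + 1 - m)), Finset.smul_sum,
      ← Finset.sum_filter]
    · refine Finset.sum_bij' (fun i _ => m + i) (fun j _ => j - m) ?_ ?_ ?_ ?_ ?_
      · intro i hi
        simp only [Finset.mem_range, Finset.mem_filter] at hi ⊢
        omega
      · intro j hj
        simp only [Finset.mem_range, Finset.mem_filter] at hj ⊢
        omega
      · intro i _
        omega
      · intro j hj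
        simp only [Finset.mem_range, Finset.mem_filter] at hj ⊢
        omega
      · intro i _
        rw [smul_smul, Nat.add_sub_cancel_left]
        push_cast
        rfl
    · intro i hi
      simp only [Finset.coe_range, Set.mem_Iio]
      by_contra hc
      exact hi (by simp [hZ (m + i) (by omega)])
  rw [Finset.sum_congr rfl h1, Finset.sum_comm, Finset.sum_eq_single 0]
  · rw [Finset.sum_eq_single 0]
    · simp
    · intro m _ hm
      simp [hm]
    · simp
  · intro j hj hj0
    rw [← Finset.sum_filter, ← Finset.sum_smul]
    have e : Finset.filter (fun m => m ≤ j) (Finset.range (n + 1)) = Finset.range (j + 1) := by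
      ext m
      simp only [Finset.mem_range, Finset.mem_filter] at hj ⊢
      omega
    rw [e, ← Int.cast_sum, sum_choose_mul_choose, if_neg hj0]
    simp
  · simp

theorem neg_one_pow_mul_choose (p : ℤ) (i : ℕ) :
    (-1) ^ i * Ring.choose (-p - 1 + i) i = Ring.choose p i := by
  have h := Ring.choose_neg (-p) i
  rw [neg_neg] at h
  rw [h, show -p - 1 + (i : ℤ) = -p + i - 1 by ring, Int.negOnePow_def]
  simp [Units.smul_def]

/-- Reflection of the upper index. It matches the coefficients of `rightEntry`, which come from the
substitution $-x(1+x)^{-1}$, with those on the right-hand side of the Jacobi identity. -/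
theorem neg_one_zpow_mul_choose (r p : ℤ) (i : ℕ) :
    (-1 : ℂ) ^ (r + i + 1) * (Ring.choose (-p - 1 + i) i : ℤ)
      = (-1 : ℂ) ^ (r + 1) * (Ring.choose p i : ℤ) := by
  rw [← neg_one_pow_mul_choose p i, add_right_comm, zpow_add₀ (by norm_num), zpow_natCast]
  push_cast
  ring

theorem neg_one_zpow_smul_neg {M : Type*} [AddCommGroup M] [Module ℂ M] (r : ℤ) (c : ℂ) (x : M) :
    (-1 : ℂ) ^ (r + 1) • c • (-((-1 : ℂ) ^ r • x)) = c • x := by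
  have h : (-1 : ℂ) ^ (r + 1) * (-1) ^ r = -1 := by
    rw [zpow_add_one₀ (by norm_num), mul_right_comm, ← zpow_add₀ (by norm_num),
      (Even.add_self r).neg_one_zpow]
    norm_num
  rw [smul_comm, smul_neg, smul_smul, h, neg_smul, one_smul, neg_neg]

end Binomial

/-! ### The maps $\vartheta_W$ on weight components. -/

variable {V : Type u} [AddCommGroup V] [Module ℂ V] {𝒱 : VertexAlgebra V}

theorem VertexAlgebra.proj_of_mem {a : ℤ} {v : V} (hv : v ∈ 𝒱.gr a) : 𝒱.proj a v = v :=
  component_of_mem _ hv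

theorem VertexAlgebra.proj_of_mem_ne {a a' : ℤ} (h : a ≠ a') {v : V} (hv : v ∈ 𝒱.gr a) :
    𝒱.proj a' v = 0 :=
  component_of_mem_ne _ h hv

namespace LBModule

variable {W : Type u} [AddCommGroup W] [Module ℂ W] (M : LBModule 𝒱 W)

theorem proj_mem (h : ℂ) (w : W) : M.proj h w ∈ M.gr h := component_mem _ _ _ _

theorem proj_of_mem {h : ℂ} {w : W} (hw : w ∈ M.gr h) : M.proj h w = w :=
  component_of_mem _ hw

theorem proj_of_mem_ne {h h' : ℂ} (hh : h ≠ h') {w : W} (hw : w ∈ M.gr h) : M.proj h' w = 0 :=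
  component_of_mem_ne _ hh hw

theorem ext_proj {w w' : W} (h : ∀ t, M.proj t w = M.proj t w') : w = w' :=
  ext_component _ h

open Classical in
theorem thetaEntry_of_mem (k l : ℕ) {a : ℤ} {s : ℂ} {v : V} {w : W} (hv : v ∈ 𝒱.gr a)
    (hw : w ∈ M.gr s) :
    M.thetaEntry k l v w
      = if s - l ∈ minWeights M.gr then M.Y (a + l - k - 1) v w else 0 := by
  rw [thetaEntry, sumBilin_eq_single _ _ _ _ (a, s)]
  · split_ifs
    · simp [VertexAlgebra.proj_of_mem hv, M.proj_of_mem hw]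
    · rfl
  · rintro ⟨a', s'⟩ hne
    split_ifs
    · by_cases ha : a = a'
      · have hs : s ≠ s' := fun hs => hne (by rw [ha, hs])
        simp [M.proj_of_mem_ne hs hw]
      · simp [VertexAlgebra.proj_of_mem_ne ha hv]
    · rfl

open Classical in
-- The coefficient with index $a+n-k-1$ shifts weights by $k-n$, so the component of weight $t$ can
-- only come from weight $t-k+n$.
theorem proj_thetaEntry (k n : ℕ) {a : ℤ} {v : V} (hv : v ∈ 𝒱.gr a) (w : W) (t : ℂ) :
    M.proj t (M.thetaEntry k n v w)
      = if t - k ∈ minWeights M.gr then M.Y (a + n - k - 1) v (M.proj (t - k + n) w) else 0 := by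
  have key : M.proj t ∘ₗ M.thetaEntry k n v
      = if t - k ∈ minWeights M.gr then M.Y (a + n - k - 1) v ∘ₗ M.proj (t - k + n) else 0 := by
    refine ext_of_isInternal M.isInternal fun s w hw => ?_
    rw [LinearMap.comp_apply, M.thetaEntry_of_mem k n hv hw]
    by_cases hs : s = t - k + n
    · rw [show s - (n : ℂ) = t - k by rw [hs]; ring]
      split_ifs
      · have := M.Y_mem_gr (n := a + n - k - 1) hv hw
        rw [show s + a - ((a + n - k - 1 : ℤ) : ℂ) - 1 = t by push_cast; rw [hs]; ring] at this
        rw [M.proj_of_mem this, LinearMap.comp_apply, ← hs, M.proj_of_mem hw]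
      · simp
    · have h1 : M.proj t (if s - n ∈ minWeights M.gr then M.Y (a + n - k - 1) v w else 0) = 0 := by
        split_ifs
        · refine M.proj_of_mem_ne (fun h => hs ?_) (M.Y_mem_gr (n := a + n - k - 1) hv hw)
          push_cast at h
          linear_combination h
        · simp
      rw [h1]
      split_ifs
      · rw [LinearMap.comp_apply, M.proj_of_mem_ne hs hw, map_zero]
      · rfl
  have := LinearMap.congr_fun key w
  rw [LinearMap.comp_apply] at this
  rw [this]
  split_ifs <;> rfl

/-- A vector whose nonzero components all have level `n'` is annihilated by the entries in the
columns different from `n'`. -/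
theorem thetaEntry_eq_zero_of_ne {k n n' : ℕ} (hn : n ≠ n') (v : V) {w : W}
    (hw : ∀ t, M.proj t w ≠ 0 → t - n' ∈ minWeights M.gr) : M.thetaEntry k n v w = 0 := by
  by_contra h
  obtain ⟨s, hs, hs'⟩ := M.thetaEntry_ne_zero h
  exact hn (minWeights_unique M.gr hs' (hw s hs))

theorem sub_mem_minWeights_of_proj_thetaEntry {k n : ℕ} {v : V} {w : W} {t : ℂ}
    (h : M.proj t (M.thetaEntry k n v w) ≠ 0) : t - k ∈ minWeights M.gr := by
  classical
  by_contra hc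
  apply h
  have : M.proj t ∘ₗ (M.thetaEntry k n).flip w = 0 := by
    refine ext_of_isInternal 𝒱.isInternal fun a v hv => ?_
    rw [LinearMap.comp_apply, LinearMap.flip_apply, M.proj_thetaEntry k n hv, if_neg hc]
    rfl
  exact LinearMap.congr_fun this v

theorem theta_eq_sum {N : ℕ} {A : UInf V} (hA : A ∈ UN V N) (w : W) :
    M.theta A w = ∑ k ∈ Finset.range (N + 1), ∑ l ∈ Finset.range (N + 1),
      M.thetaEntry k l (A.1 k l) w := by
  rw [← Finset.sum_product']
  refine finsum_eq_sum_of_support_subset _ fun x hx => ?_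
  simp only [Finset.coe_product, Finset.coe_range, Set.mem_prod, Set.mem_Iio]
  by_contra hc
  apply hx
  simp only [LinearMap.comp_apply, entry_apply]
  rw [hA x.1 x.2 (by omega)]
  simp

end LBModule

/-! ### Homogeneity of intertwining operators and the maps $\vartheta_{\mathcal Y}$. -/

section Intertwining

variable {W₁ W₂ W₃ : Type u} [AddCommGroup W₁] [Module ℂ W₁] [AddCommGroup W₂] [Module ℂ W₂]
  [AddCommGroup W₃] [Module ℂ W₃]
  {M₁ : LBModule 𝒱 W₁} {M₂ : LBModule 𝒱 W₂} {M₃ : LBModule 𝒱 W₃}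

/-- The $L(-1)$-derivative property at index $n+1$ removes $L(-1)$ from the $L(0)$-commutator. The
price is a term with a higher power of $\log x$. -/
theorem IsIntertwining.L0_sub {𝒴 : ℂ → ℕ → W₁ →ₗ[ℂ] W₂ →ₗ[ℂ] W₃}
    (h : IsIntertwining M₁ M₂ M₃ 𝒴) (n b s : ℂ) (k : ℕ) (w₁ : W₁) (w₂ : W₂) :
    (M₃.L0 - (b + s - n - 1) • (1 : Module.End ℂ W₃)) (𝒴 n k w₁ w₂)
      = 𝒴 n k ((M₁.L0 - b • (1 : Module.End ℂ W₁)) w₁) w₂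
        + 𝒴 n k w₁ ((M₂.L0 - s • (1 : Module.End ℂ W₂)) w₂)
        + (k + 1 : ℂ) • 𝒴 n (k + 1) w₁ w₂ := by
  have h1 := h.L0_bracket n k w₁ w₂
  rw [h.Lm1_derivative, sub_eq_iff_eq_add, add_sub_cancel_right] at h1
  simp only [LinearMap.sub_apply, LinearMap.smul_apply, Module.End.one_apply, map_sub, map_smul,
    h1]
  module

/-- The coefficient of `x ^ (-n-1) (log x) ^ k` adds `-n-1` to the weights. -/
theorem IsIntertwining.mem_gr {𝒴 : ℂ → ℕ → W₁ →ₗ[ℂ] W₂ →ₗ[ℂ] W₃}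
    (h : IsIntertwining M₁ M₂ M₃ 𝒴) {b s : ℂ} (n : ℂ) (k : ℕ) {w₁ : W₁} {w₂ : W₂}
    (h₁ : w₁ ∈ M₁.gr b) (h₂ : w₂ ∈ M₂.gr s) : 𝒴 n k w₁ w₂ ∈ M₃.gr (b + s - n - 1) := by
  -- A vector lies in a generalized eigenspace as soon as its image under $L(0)-\lambda$ does. With
  -- `L0_sub` this permits a nested induction on the nilpotency orders of $w_1$ and $w_2$ and on the
  -- power of $\log x$.
  have step : ∀ u : W₃, (M₃.L0 - (b + s - n - 1) • (1 : Module.End ℂ W₃)) u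
      ∈ M₃.gr (b + s - n - 1) → u ∈ M₃.gr (b + s - n - 1) := by
    intro u hu
    unfold LBModule.gr at hu ⊢
    rw [Module.End.mem_maxGenEigenspace] at hu ⊢
    obtain ⟨j, hj⟩ := hu
    exact ⟨j + 1, by rw [pow_succ, Module.End.mul_apply, hj]⟩
  have main : ∀ i : ℕ, ∀ w₁ : W₁, ((M₁.L0 - b • (1 : Module.End ℂ W₁)) ^ i) w₁ = 0 →
      ∀ j : ℕ, ∀ w₂ : W₂, ((M₂.L0 - s • (1 : Module.End ℂ W₂)) ^ j) w₂ = 0 →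
      ∀ k, 𝒴 n k w₁ w₂ ∈ M₃.gr (b + s - n - 1) := by
    intro i
    induction i with
    | zero =>
      intro w₁ hw₁ j w₂ _ k
      rw [pow_zero, Module.End.one_apply] at hw₁
      simp [hw₁]
    | succ i ihi =>
      intro w₁ hw₁ j
      induction j with
      | zero =>
        intro w₂ hw₂ k
        rw [pow_zero, Module.End.one_apply] at hw₂
        simp [hw₂]
      | succ j ihj =>
        intro w₂ hw₂ k
        obtain ⟨K, hK⟩ := h.log_polynomial w₁ w₂ n
        -- Descending induction on $k$, starting at the powers of $\log x$ that do not occur.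
        have down : ∀ d k, K ≤ k + d → 𝒴 n k w₁ w₂ ∈ M₃.gr (b + s - n - 1) := by
          intro d
          induction d with
          | zero =>
            intro k hk
            rw [hK k (by omega)]
            exact Submodule.zero_mem _
          | succ d ihd =>
            intro k hk
            apply step
            rw [h.L0_sub]
            refine Submodule.add_mem _ (Submodule.add_mem _ ?_ ?_)
              (Submodule.smul_mem _ _ (ihd _ (by omega)))
            · exact ihi _ (by rwa [pow_succ, Module.End.mul_apply] at hw₁) _ _ hw₂ _
            · exact ihj _ (by rwa [pow_succ, Module.End.mul_apply] at hw₂) _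
        exact down K k (by omega)
  unfold LBModule.gr at h₁ h₂
  rw [Module.End.mem_maxGenEigenspace] at h₁ h₂
  obtain ⟨i, hi⟩ := h₁
  obtain ⟨j, hj⟩ := h₂
  exact main i w₁ hi j w₂ hj k

namespace Intertwiners

variable (𝒴 : Intertwiners M₁ M₂ M₃)

theorem mem_gr_of_eq {b s n t : ℂ} {w₁ : W₁} {w₂ : W₂} (h₁ : w₁ ∈ M₁.gr b) (h₂ : w₂ ∈ M₂.gr s)
    (k : ℕ) (ht : b + s - n - 1 = t) : 𝒴.1 n k w₁ w₂ ∈ M₃.gr t :=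
  ht ▸ 𝒴.2.mem_gr n k h₁ h₂

open Classical in
-- Each term of the sum defining $\vartheta_{\mathcal Y}$ has its own weight $t$, so a weight
-- component picks out one coefficient of $\mathcal Y^0$. All later computations with
-- $\vartheta_{\mathcal Y}$ go through this.
theorem proj_thetaEntry (k l : ℕ) {b s : ℂ} {w₁ : W₁} {w₂ : W₂} (h₁ : w₁ ∈ M₁.gr b)
    (h₂ : w₂ ∈ M₂.gr s) (t : ℂ) :
    M₃.proj t (thetaEntry 𝒴 k l w₁ w₂)
      = if s - l ∈ minWeights M₂.gr ∧ t - k ∈ minWeights M₃.gr then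
          𝒴.1 (b + s - t - 1) 0 w₁ w₂ else 0 := by
  rw [thetaEntry, map_sumBilin, finsum_eq_single _ ((b, s), t)]
  · split_ifs
    · rw [LinearMap.compl₁₂_apply, M₁.proj_of_mem h₁, M₂.proj_of_mem h₂]
      exact M₃.proj_of_mem (mem_gr_of_eq 𝒴 h₁ h₂ 0 (by ring))
    · simp
  · rintro ⟨⟨b', s'⟩, t'⟩ hne
    split_ifs
    · rw [LinearMap.compl₁₂_apply]
      by_cases hb : b = b'
      · by_cases hs : s = s'
        · have ht : t' ≠ t := fun ht => hne (by rw [hb, hs, ht])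
          subst hb hs
          refine M₃.proj_of_mem_ne ht (mem_gr_of_eq 𝒴 (M₁.proj_mem _ _) (M₂.proj_mem _ _) 0 ?_)
          ring
        · simp [M₂.proj_of_mem_ne hs h₂]
      · simp [M₁.proj_of_mem_ne hb h₁]
    · simp

/-- Bilinear maps to `W₃` agree if they have the same components on homogeneous vectors. -/
theorem bilin_ext {f g : W₁ →ₗ[ℂ] W₂ →ₗ[ℂ] W₃} (M₁ : LBModule 𝒱 W₁) (M₂ : LBModule 𝒱 W₂)
    (M₃ : LBModule 𝒱 W₃)
    (hfg : ∀ b, ∀ w₁ ∈ M₁.gr b, ∀ s, ∀ w₂ ∈ M₂.gr s, ∀ t,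
      M₃.proj t (f w₁ w₂) = M₃.proj t (g w₁ w₂)) : f = g :=
  ext_of_isInternal M₁.isInternal fun b w₁ h₁ =>
    ext_of_isInternal M₂.isInternal fun s w₂ h₂ => M₃.ext_proj (hfg b w₁ h₁ s w₂ h₂)

theorem sub_mem_minWeights_of_proj_thetaEntry {k l : ℕ} {w₁ : W₁} {w₂ : W₂} {t : ℂ}
    (h : M₃.proj t (thetaEntry 𝒴 k l w₁ w₂) ≠ 0) : t - k ∈ minWeights M₃.gr := by
  classical
  by_contra hc
  apply h
  have : (thetaEntry 𝒴 k l).compr₂ (M₃.proj t) = 0 := by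
    refine ext_of_isInternal M₁.isInternal fun b w₁ h₁ =>
      ext_of_isInternal M₂.isInternal fun s w₂ h₂ => ?_
    rw [LinearMap.compr₂_apply, proj_thetaEntry 𝒴 k l h₁ h₂, if_neg fun hk => hc hk.2]
    rfl
  exact LinearMap.congr_fun₂ this w₁ w₂

theorem thetaEntry_mem_level (k l : ℕ) (w₁ : W₁) (w₂ : W₂) :
    thetaEntry 𝒴 k l w₁ w₂ ∈ level M₃.gr k := by
  classical
  refine finsum_induction (· ∈ level M₃.gr k) (Submodule.zero_mem _)
    (fun _ _ => Submodule.add_mem _) fun x => ?_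
  beta_reduce
  split_ifs with hx
  · refine Submodule.mem_iSup_of_mem (x.2 - k) (Submodule.mem_iSup_of_mem hx.2 ?_)
    rw [LinearMap.compl₁₂_apply]
    exact mem_gr_of_eq 𝒴 (M₁.proj_mem _ _) (M₂.proj_mem _ _) 0 (by ring)
  · exact Submodule.zero_mem _

theorem theta_eq_sum {N : ℕ} {A : UInf W₁} (hA : A ∈ UN W₁ N) (w : W₂) :
    theta 𝒴 A w = ∑ k ∈ Finset.range (N + 1), ∑ l ∈ Finset.range (N + 1),
      thetaEntry 𝒴 k l (A.1 k l) w := by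
  rw [← Finset.sum_product']
  refine finsum_eq_sum_of_support_subset _ fun x hx => ?_
  simp only [Finset.coe_product, Finset.coe_range, Set.mem_prod, Set.mem_Iio]
  by_contra hc
  apply hx
  simp only [LinearMap.comp_apply, entry_apply]
  rw [hA x.1 x.2 (by omega)]
  simp

theorem theta_mem_Omega {N : ℕ} {A : UInf W₁} (hA : A ∈ UN W₁ N) (w : W₂) :
    theta 𝒴 A w ∈ Omega M₃.gr N := by
  rw [theta_eq_sum 𝒴 hA]
  exact Submodule.sum_mem _ fun k hk => Submodule.sum_mem _ fun l _ =>
    Submodule.mem_iSup_of_mem k (Submodule.mem_iSup_of_mem hk (thetaEntry_mem_level 𝒴 _ _ _ _))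

/-- The supports of the defining sums vary with the operator. Comparing weight components avoids
them, since each component is one coefficient and depends linearly on the operator. -/
theorem thetaEntry_add (𝒵 : Intertwiners M₁ M₂ M₃) (k l : ℕ) :
    thetaEntry (𝒴 + 𝒵) k l = thetaEntry 𝒴 k l + thetaEntry 𝒵 k l := by
  classical
  refine bilin_ext M₁ M₂ M₃ fun b w₁ h₁ s w₂ h₂ t => ?_
  rw [LinearMap.add_apply, LinearMap.add_apply, map_add]
  simp only [proj_thetaEntry _ k l h₁ h₂ t]
  split_ifs <;> simp

theorem thetaEntry_smul (c : ℂ) (k l : ℕ) :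
    thetaEntry (c • 𝒴) k l = c • thetaEntry 𝒴 k l := by
  classical
  refine bilin_ext M₁ M₂ M₃ fun b w₁ h₁ s w₂ h₂ t => ?_
  rw [LinearMap.smul_apply, LinearMap.smul_apply, map_smul]
  simp only [proj_thetaEntry _ k l h₁ h₂ t]
  split_ifs <;> simp

end Intertwiners

end Intertwining

/-! ### The entries of $\diamond$ as bilinear maps. -/

namespace LBModule

variable {W : Type u} [AddCommGroup W] [Module ℂ W] (M : LBModule 𝒱 W)

/-- The residue of `x ^ r f_a(x) Y_W(v, x) w` for `v` of weight `a`, where `f_a` is the power series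
with coefficients `c a i`. -/
noncomputable def residueBilin (c : ℤ → ℕ → ℂ) (r : ℤ) : V →ₗ[ℂ] W →ₗ[ℂ] W :=
  sumBilin (fun a : ℤ => (sumBilin (fun i : ℕ => c a i • M.Y (r + i)) (fun v w => by
      obtain ⟨K, hK⟩ := M.truncation v w
      refine (Set.finite_lt_nat (K - r).toNat).subset fun i hi => ?_
      by_contra hc
      simp only [Set.mem_ofPred_eq, not_lt] at hc
      exact hi (by simp [hK (r + i) (by omega)]))).compl₁₂ (𝒱.proj a) LinearMap.id)
    (fun v w => by
      refine (component_finite 𝒱.gr 𝒱.isInternal v).subset fun a ha h0 => ha ?_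
      have h0' : 𝒱.proj a v = 0 := h0
      simp [h0'])

theorem residueBilin_apply (c : ℤ → ℕ → ℂ) (r : ℤ) (v : V) (w : W) :
    M.residueBilin c r v w = ∑ᶠ a : ℤ, ∑ᶠ i : ℕ, c a i • M.Y (r + i) (𝒱.proj a v) w := rfl

theorem map_residueBilin {D : Type*} [AddCommGroup D] [Module ℂ D] (g : W →ₗ[ℂ] D)
    (c : ℤ → ℕ → ℂ) (r : ℤ) {a : ℤ} {v : V} (hv : v ∈ 𝒱.gr a) (w : W) :
    g (M.residueBilin c r v w) = ∑ᶠ i : ℕ, c a i • g (M.Y (r + i) v w) := by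
  rw [residueBilin, sumBilin_eq_single _ _ _ _ a, LinearMap.compl₁₂_apply, map_sumBilin,
    VertexAlgebra.proj_of_mem hv]
  · simp
  · intro a' ha'
    simp [VertexAlgebra.proj_of_mem_ne ha'.symm hv]

/-- The left multiplication by matrix entries, as a bilinear map. -/
noncomputable def leftBilin (k n l : ℕ) : V →ₗ[ℂ] W →ₗ[ℂ] W :=
  ∑ m ∈ Finset.range (n + 1), ((Ring.choose (-k + n - l - 1 : ℤ) m : ℤ) : ℂ) •
    M.residueBilin (fun a i => ((Ring.choose (l + a) i : ℤ) : ℂ)) (-k + n - l - m - 1)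

/-- The right multiplication by matrix entries, as a bilinear map. -/
noncomputable def rightBilin (k n l : ℕ) : V →ₗ[ℂ] W →ₗ[ℂ] W :=
  ∑ m ∈ Finset.range (n + 1), ((Ring.choose (-k + n - l - 1 : ℤ) m : ℤ) : ℂ) •
    M.residueBilin (fun a i => (-1 : ℂ) ^ (-k + n - l - m - 1 + i + 1 : ℤ) *
        (Ring.choose (k - a + (-k + n - l - m - 1 + i) + 1) i : ℤ)) (-k + n - l - m - 1)

theorem leftBilin_apply (k n l : ℕ) (v : V) (w : W) :
    M.leftBilin k n l v w = leftEntry M k n l v w := by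
  simp only [leftBilin, leftEntry, LinearMap.sum_apply, LinearMap.smul_apply, residueBilin_apply]

theorem rightBilin_apply (k n l : ℕ) (v : V) (w : W) :
    M.rightBilin k n l v w = rightEntry M k n l w v := by
  simp only [rightBilin, rightEntry, LinearMap.sum_apply, LinearMap.smul_apply, residueBilin_apply]

theorem map_leftEntry {D : Type*} [AddCommGroup D] [Module ℂ D] (g : W →ₗ[ℂ] D)
    (k n l : ℕ) {a : ℤ} {v : V} (hv : v ∈ 𝒱.gr a) (w : W) :
    g (leftEntry M k n l v w)
      = ∑ m ∈ Finset.range (n + 1), ((Ring.choose (-k + n - l - 1 : ℤ) m : ℤ) : ℂ) •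
        ∑ᶠ i : ℕ, ((Ring.choose (l + a) i : ℤ) : ℂ) • g (M.Y (-k + n - l - m - 1 + i) v w) := by
  rw [← leftBilin_apply]
  simp only [leftBilin, LinearMap.sum_apply, LinearMap.smul_apply, map_sum, map_smul,
    M.map_residueBilin g _ _ hv]

theorem map_rightEntry {D : Type*} [AddCommGroup D] [Module ℂ D] (g : W →ₗ[ℂ] D)
    (k n l : ℕ) {a : ℤ} {v : V} (hv : v ∈ 𝒱.gr a) (w : W) :
    g (rightEntry M k n l w v)
      = ∑ m ∈ Finset.range (n + 1), ((Ring.choose (-k + n - l - 1 : ℤ) m : ℤ) : ℂ) •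
        ∑ᶠ i : ℕ, ((-1 : ℂ) ^ (-k + n - l - m - 1 + i + 1 : ℤ) *
          (Ring.choose (k - a + (-k + n - l - m - 1 + i) + 1) i : ℤ)) •
            g (M.Y (-k + n - l - m - 1 + i) v w) := by
  rw [← rightBilin_apply]
  simp only [rightBilin, LinearMap.sum_apply, LinearMap.smul_apply, map_sum, map_smul,
    M.map_residueBilin g _ _ hv]

theorem Y_mem_gr_of_eq {a n : ℤ} {h t : ℂ} {v : V} {w : W} (hv : v ∈ 𝒱.gr a) (hw : w ∈ M.gr h)
    (ht : h + a - n - 1 = t) : M.Y n v w ∈ M.gr t :=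
  ht ▸ M.Y_mem_gr hv hw

/-- Components below a minimal weight vanish. -/
theorem eq_zero_of_mem_lt_minWeight {h t : ℂ} (hh : h ∈ minWeights M.gr) {w : W}
    (hw : w ∈ M.gr t) (m : ℕ) (hm : 0 < m) (ht : t = h - m) : w = 0 := by
  rw [ht, hh.2 m hm] at hw
  exact hw

end LBModule

/-! ### Compatibility of $\vartheta_{\mathcal Y}$ with the left and right actions. -/

namespace Intertwiners

variable {W₁ W₂ W₃ : Type u} [AddCommGroup W₁] [Module ℂ W₁] [AddCommGroup W₂] [Module ℂ W₂]
  [AddCommGroup W₃] [Module ℂ W₃]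
  {M₁ : LBModule 𝒱 W₁} {M₂ : LBModule 𝒱 W₂} {M₃ : LBModule 𝒱 W₃}
  (𝒴 : Intertwiners M₁ M₂ M₃)

/-- On homogeneous vectors and in one weight of $W_3$, this is the Jacobi identity without the
product in which $v$ acts on $W_2$, summed over $m$. -/
theorem thetaEntry_leftEntry (k n l : ℕ) (v : V) (w₁ : W₁) (w₂ : W₂) :
    thetaEntry 𝒴 k l (leftEntry M₁ k n l v w₁) w₂
      = M₃.thetaEntry k n v (thetaEntry 𝒴 n l w₁ w₂) := by
  classical
  rw [← LBModule.leftBilin_apply]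
  suffices h : (thetaEntry 𝒴 k l).flip w₂ ∘ₗ (M₁.leftBilin k n l).flip w₁
      = (M₃.thetaEntry k n).flip (thetaEntry 𝒴 n l w₁ w₂) from LinearMap.congr_fun h v
  refine ext_of_isInternal 𝒱.isInternal fun a v hv => ?_
  suffices h : thetaEntry 𝒴 k l ∘ₗ M₁.leftBilin k n l v
      = (thetaEntry 𝒴 n l).compr₂ (M₃.thetaEntry k n v) from LinearMap.congr_fun₂ h w₁ w₂
  refine bilin_ext M₁ M₂ M₃ fun b w₁ h₁ s w₂ h₂ t => ?_
  rw [LinearMap.comp_apply, LinearMap.compr₂_apply, LBModule.leftBilin_apply,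
    M₃.proj_thetaEntry k n hv, proj_thetaEntry 𝒴 n l h₁ h₂, add_sub_cancel_right]
  have e := M₁.map_leftEntry (M₃.proj t ∘ₗ (thetaEntry 𝒴 k l).flip w₂) k n l hv w₁
  simp only [LinearMap.comp_apply, LinearMap.flip_apply,
    proj_thetaEntry 𝒴 k l (M₁.Y_mem_gr hv h₁) h₂] at e
  rw [e]
  by_cases hs : s - l ∈ minWeights M₂.gr
  swap
  · simp [hs]
  by_cases ht : t - k ∈ minWeights M₃.gr
  swap
  · simp [ht]
  simp only [hs, ht, and_self, if_true]
  -- $Z_0$ is the required composition. The inner vector in $Z_j$ has weight $(t-k)+n-j$, which is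
  -- below the minimal weight $t-k$ when $j>n$.
  have hZ := sum_choose_smul_truncated (-k + n - l - 1 : ℤ) n
    (fun j => M₃.Y (a + n - k - 1 - j) v (𝒴.1 (b + s - (t - k + n) - 1 + j) 0 w₁ w₂)) (by
      intro j hj
      have : 𝒴.1 (b + s - (t - k + n) - 1 + j) 0 w₁ w₂ = 0 :=
        M₃.eq_zero_of_mem_lt_minWeight ht (mem_gr_of_eq 𝒴 h₁ h₂ 0 rfl) (j - n) (by omega) (by
          rw [Nat.cast_sub hj.le]; ring)
      rw [this, map_zero])
  simp only [Nat.cast_zero, sub_zero, add_zero] at hZ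
  rw [← hZ]
  refine Finset.sum_congr rfl fun m _ => ?_
  congr 1
  -- The index $p=l+a$ reproduces the factor $(1+x)^{l+a}$ of the product. It also makes the modes
  -- of $v$ on $w_2$ land in weights $s-l-i-1$, below the minimal weight $s-l$.
  have hJ := 𝒴.2.jacobi 0 v w₁ w₂ (l + a) (-k + n - l - m - 1)
    (b - (-k + n - l - m - 1) - 2 + s - t - l)
  refine Eq.trans (finsum_congr fun i => ?_) (hJ.symm.trans (finsum_congr fun i => ?_))
  · congr 3
    push_cast
    ring_nf
  · have h0 : M₂.Y (l + a + i) v w₂ = 0 :=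
      M₂.eq_zero_of_mem_lt_minWeight hs (M₂.Y_mem_gr hv h₂) (i + 1) (by omega) (by
        push_cast; ring)
    rw [h0, map_zero, smul_zero, sub_zero]
    congr 3
    · ring_nf
    · push_cast
      ring_nf
    · congr 2
      push_cast
      ring_nf

/-- The mirror image of the left case: now the product in which $v$ acts on $W_3$ drops out of the
Jacobi identity. -/
theorem thetaEntry_rightEntry (k n l : ℕ) (v : V) (w₁ : W₁) (w₂ : W₂) :
    thetaEntry 𝒴 k l (rightEntry M₁ k n l w₁ v) w₂
      = thetaEntry 𝒴 k n w₁ (M₂.thetaEntry n l v w₂) := by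
  classical
  rw [← LBModule.rightBilin_apply]
  suffices h : (thetaEntry 𝒴 k l).flip w₂ ∘ₗ (M₁.rightBilin k n l).flip w₁
      = thetaEntry 𝒴 k n w₁ ∘ₗ (M₂.thetaEntry n l).flip w₂ from LinearMap.congr_fun h v
  refine ext_of_isInternal 𝒱.isInternal fun a v hv => ?_
  suffices h : thetaEntry 𝒴 k l ∘ₗ M₁.rightBilin k n l v
      = (thetaEntry 𝒴 k n).compl₂ (M₂.thetaEntry n l v) from LinearMap.congr_fun₂ h w₁ w₂
  refine bilin_ext M₁ M₂ M₃ fun b w₁ h₁ s w₂ h₂ t => ?_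
  rw [LinearMap.comp_apply, LinearMap.compl₂_apply, LBModule.rightBilin_apply,
    M₂.thetaEntry_of_mem n l hv h₂]
  have e := M₁.map_rightEntry (M₃.proj t ∘ₗ (thetaEntry 𝒴 k l).flip w₂) k n l hv w₁
  simp only [LinearMap.comp_apply, LinearMap.flip_apply,
    proj_thetaEntry 𝒴 k l (M₁.Y_mem_gr hv h₁) h₂] at e
  rw [e]
  by_cases hs : s - l ∈ minWeights M₂.gr
  swap
  · simp [hs]
  rw [if_pos hs, proj_thetaEntry 𝒴 k n h₁
    (M₂.Y_mem_gr_of_eq (t := s - l + n) hv h₂ (by push_cast; ring)), add_sub_cancel_right]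
  by_cases ht : t - k ∈ minWeights M₃.gr
  swap
  · simp [ht]
  simp only [hs, ht, and_self, if_true]
  -- Here the inner vector lies in $W_2$ and has weight $(s-l)+n-j$, with $s-l$ minimal.
  have hZ := sum_choose_smul_truncated (-k + n - l - 1 : ℤ) n
    (fun j => 𝒴.1 (b + (s - l + n) - t - 1 - j) 0 w₁ (M₂.Y (a + l - n - 1 + j) v w₂)) (by
      intro j hj
      have : M₂.Y (a + l - n - 1 + j) v w₂ = 0 :=
        M₂.eq_zero_of_mem_lt_minWeight hs (M₂.Y_mem_gr hv h₂) (j - n) (by omega) (by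
          rw [Nat.cast_sub hj.le]; push_cast; ring)
      rw [this, map_zero])
  simp only [Nat.cast_zero, sub_zero, add_zero] at hZ
  rw [← hZ]
  refine Finset.sum_congr rfl fun m _ => ?_
  congr 1
  -- With $q=b+s-t+k$ the coefficients $\mathcal Y_{q+i,0}(w_1)w_2$ have weights $t-k-i-1$ and
  -- vanish. With this $p$ the reflected binomials of `rightEntry` become $\binom pi$. The factor
  -- $(-1)^{r+1}$ cancels the sign of the remaining product.
  have hJ := 𝒴.2.jacobi 0 v w₁ w₂ (-k + a - (-k + n - l - m - 1) - 2) (-k + n - l - m - 1)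
    (b + s - t + k)
  have hJ' := congrArg (((-1 : ℂ) ^ (-k + n - l - m - 1 + 1 : ℤ)) • ·) hJ
  simp only [smul_finsum] at hJ'
  refine Eq.trans (finsum_congr fun i => ?_) (hJ'.symm.trans (finsum_congr fun i => ?_))
  · rw [smul_smul, ← neg_one_zpow_mul_choose _ (-k + a - (-k + n - l - m - 1) - 2)]
    congr 1
    · congr 3
      ring
    · congr 3
      push_cast
      ring_nf
  · have h0 : 𝒴.1 (b + s - t + k + i) 0 w₁ w₂ = 0 :=
      M₃.eq_zero_of_mem_lt_minWeight ht (mem_gr_of_eq 𝒴 h₁ h₂ 0 rfl) (i + 1) (by omega) (by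
        push_cast; ring)
    rw [h0, map_zero, zero_sub, neg_one_zpow_smul_neg]
    congr 3
    · ring_nf
    · push_cast
      ring_nf
    · congr 2
      push_cast
      ring_nf

theorem leftMul_mem_UN {N : ℕ} {A : UInf V} (hA : A ∈ UN V N) {B : UInf W₁} (hB : B ∈ UN W₁ N) :
    leftMul M₁ A B ∈ UN W₁ N := by
  intro k l h
  refine finsum_eq_zero_of_forall_eq_zero fun n => ?_
  rcases h with h | h
  · rw [hA k n (Or.inl h), leftEntry_zero_left]
  · rw [hB n l (Or.inr h), leftEntry_zero_right]

theorem rightMul_mem_UN {N : ℕ} {A : UInf V} (hA : A ∈ UN V N) {B : UInf W₁} (hB : B ∈ UN W₁ N) :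
    rightMul M₁ B A ∈ UN W₁ N := by
  intro k l h
  refine finsum_eq_zero_of_forall_eq_zero fun n => ?_
  rcases h with h | h
  · rw [hB k n (Or.inl h), rightEntry_zero_left]
  · rw [hA n l (Or.inr h), rightEntry_zero_right]

theorem leftMul_entry {N : ℕ} {A : UInf V} (hA : A ∈ UN V N) (B : UInf W₁) (k l : ℕ) :
    (leftMul M₁ A B).1 k l
      = ∑ n ∈ Finset.range (N + 1), leftEntry M₁ k n l (A.1 k n) (B.1 n l) := by
  refine finsum_eq_sum_of_support_subset _ fun n hn => ?_
  simp only [Finset.coe_range, Set.mem_Iio]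
  by_contra hc
  exact hn (by beta_reduce; rw [hA k n (by omega), leftEntry_zero_left])

theorem rightMul_entry {N : ℕ} {A : UInf V} (hA : A ∈ UN V N) (B : UInf W₁) (k l : ℕ) :
    (rightMul M₁ B A).1 k l
      = ∑ n ∈ Finset.range (N + 1), rightEntry M₁ k n l (B.1 k n) (A.1 n l) := by
  refine finsum_eq_sum_of_support_subset _ fun n hn => ?_
  simp only [Finset.coe_range, Set.mem_Iio]
  by_contra hc
  exact hn (by beta_reduce; rw [hA n l (by omega), rightEntry_zero_right])

theorem theta_leftMul {N : ℕ} {A : UInf V} (hA : A ∈ UN V N) {B : UInf W₁} (hB : B ∈ UN W₁ N)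
    (w : W₂) : theta 𝒴 (leftMul M₁ A B) w = M₃.theta A (theta 𝒴 B w) := by
  rw [theta_eq_sum 𝒴 (leftMul_mem_UN hA hB), M₃.theta_eq_sum hA, theta_eq_sum 𝒴 hB]
  refine Finset.sum_congr rfl fun k _ => ?_
  simp only [leftMul_entry hA, map_sum, LinearMap.sum_apply, thetaEntry_leftEntry]
  rw [Finset.sum_comm]
  refine Finset.sum_congr rfl fun n hn => ?_
  symm
  -- Row $n$ of $\vartheta_{\mathcal Y}$ produces only level $n$, which every column $n'\ne n$ of
  -- $\vartheta_{W_3}$ kills. This matches $[v]_{kn'}\diamond[w]_{nl}=0$.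
  refine Finset.sum_eq_single_of_mem n hn fun n' _ hne => Finset.sum_eq_zero fun l _ => ?_
  exact M₃.thetaEntry_eq_zero_of_ne hne.symm _ fun t => sub_mem_minWeights_of_proj_thetaEntry 𝒴

theorem theta_rightMul {N : ℕ} {A : UInf V} (hA : A ∈ UN V N) {B : UInf W₁} (hB : B ∈ UN W₁ N)
    (w : W₂) : theta 𝒴 (rightMul M₁ B A) w = theta 𝒴 B (M₂.theta A w) := by
  rw [theta_eq_sum 𝒴 (rightMul_mem_UN hA hB), M₂.theta_eq_sum hA, theta_eq_sum 𝒴 hB]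
  refine Finset.sum_congr rfl fun k _ => ?_
  simp only [rightMul_entry hA, map_sum, LinearMap.sum_apply, thetaEntry_rightEntry]
  rw [Finset.sum_comm]
  refine Finset.sum_congr rfl fun n hn => ?_
  symm
  refine Finset.sum_eq_single_of_mem n hn fun n' _ hne => Finset.sum_eq_zero fun l _ => ?_
  by_contra h
  obtain ⟨s, hs, hs'⟩ := thetaEntry_ne_zero 𝒴 h
  exact hne (minWeights_unique M₂.gr (M₂.sub_mem_minWeights_of_proj_thetaEntry hs) hs')

end Intertwiners

/-! ### Construction of $\rho^N$. -/

section Rho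

variable {W₁ W₂ W₃ : Type u} [AddCommGroup W₁] [Module ℂ W₁] [AddCommGroup W₂] [Module ℂ W₂]
  [AddCommGroup W₃] [Module ℂ W₃]
  {M₁ : LBModule 𝒱 W₁} {M₂ : LBModule 𝒱 W₂} {M₃ : LBModule 𝒱 W₃}

namespace Intertwiners

variable (𝒴 : Intertwiners M₁ M₂ M₃)

theorem QInf_le_ker_theta : QInf M₁ ≤ LinearMap.ker (theta 𝒴) :=
  iInf_le_of_le W₂ <| iInf_le_of_le _ <| iInf_le_of_le _ <| iInf_le_of_le M₂ <|
    iInf_le_of_le W₃ <| iInf_le_of_le _ <| iInf_le_of_le _ <| iInf_le_of_le M₃ <|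
    iInf_le_of_le 𝒴 le_rfl

/-- The map induced by `ϑ_𝒴` on `A^∞(W₁)`. -/
noncomputable def thetaInf : AInf M₁ →ₗ[ℂ] W₂ →ₗ[ℂ] W₃ :=
  (QInf M₁).liftQ (theta 𝒴) (QInf_le_ker_theta 𝒴)

theorem thetaInf_mkInf (B : UInf W₁) : thetaInf 𝒴 (mkInf M₁ B) = theta 𝒴 B := rfl

theorem thetaInf_mem_Omega {N : ℕ} (β : AN M₁ N) (w : W₂) :
    thetaInf 𝒴 β w ∈ Omega M₃.gr N := by
  obtain ⟨β, B, hB, rfl⟩ := β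
  exact theta_mem_Omega 𝒴 hB w

/-- The bilinear map on `A^N(W₁) × Ω_N^0(W₂)` induced by `ϑ_𝒴`. -/
noncomputable def thetaN (N : ℕ) : AN M₁ N →ₗ[ℂ] Omega M₂.gr N →ₗ[ℂ] Omega M₃.gr N :=
  LinearMap.mk₂ ℂ (fun β w => ⟨thetaInf 𝒴 β w, thetaInf_mem_Omega 𝒴 β w⟩)
    (fun _ _ _ => Subtype.ext (by simp)) (fun _ _ _ => Subtype.ext (by simp))
    (fun _ _ _ => Subtype.ext (by simp)) (fun _ _ _ => Subtype.ext (by simp))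

theorem coe_thetaN_apply (N : ℕ) (β : AN M₁ N) (w : Omega M₂.gr N) :
    (thetaN 𝒴 N β w : W₃) = thetaInf 𝒴 β w := rfl

/-- Compatibility with the right action is exactly what lets $\vartheta_{\mathcal Y}$ descend to the
tensor product over $A^N(V)$. -/
theorem balancedRel_le_ker (N : ℕ) :
    balancedRel M₁ M₂ N ≤ LinearMap.ker (TensorProduct.lift (thetaN 𝒴 N)) := by
  refine Submodule.span_le.2 ?_
  rintro _ ⟨β, γ, α, w, ⟨B, hB, A, hA, hβ, hα, hγ⟩, rfl⟩
  refine LinearMap.mem_ker.2 ?_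
  rw [map_sub, TensorProduct.lift.tmul, TensorProduct.lift.tmul, sub_eq_zero]
  apply Subtype.ext
  have hact : ((M₂.actN N α w : Omega M₂.gr N) : W₂) = M₂.theta A w := by
    change M₂.actInf α w = _
    rw [hα]
    rfl
  rw [coe_thetaN_apply, coe_thetaN_apply, hβ, hγ, thetaInf_mkInf, thetaInf_mkInf,
    theta_rightMul 𝒴 hA hB, hact]

/-- The map on the tensor product over `A^N(V)` induced by `ϑ_𝒴`. -/
noncomputable def homN (N : ℕ) : TensorN M₁ M₂ N →ₗ[ℂ] Omega M₃.gr N :=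
  (balancedRel M₁ M₂ N).liftQ (TensorProduct.lift (thetaN 𝒴 N)) (balancedRel_le_ker 𝒴 N)

theorem coe_homN_tmulN (N : ℕ) (β : AN M₁ N) (w : Omega M₂.gr N) :
    (homN 𝒴 N (tmulN M₁ M₂ N β w) : W₃) = thetaInf 𝒴 β w := by
  rw [homN, tmulN, Submodule.mkQ_apply, Submodule.liftQ_apply, TensorProduct.lift.tmul,
    coe_thetaN_apply]

/-- Compatibility with the left action gives $A^N(V)$-linearity. -/
theorem homN_mem (N : ℕ) : homN 𝒴 N ∈ HomN M₁ M₂ M₃ N := by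
  rintro α β γ w ⟨A, hA, B, hB, hα, hβ, hγ⟩
  apply Subtype.ext
  change _ = M₃.actInf α _
  rw [coe_homN_tmulN, coe_homN_tmulN, hα, hβ, hγ, thetaInf_mkInf, thetaInf_mkInf,
    theta_leftMul 𝒴 hA hB]
  rfl

theorem homN_ext {N : ℕ} {f g : TensorN M₁ M₂ N →ₗ[ℂ] Omega M₃.gr N}
    (h : ∀ (B : UN W₁ N) (w : Omega M₂.gr N),
      (f (tmulN M₁ M₂ N (classN M₁ N B) w) : W₃) = g (tmulN M₁ M₂ N (classN M₁ N B) w)) :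
    f = g := by
  refine Submodule.linearMap_qext _ (TensorProduct.ext' fun β w => Subtype.ext ?_)
  obtain ⟨_, B, hB, rfl⟩ := β
  exact h ⟨B, hB⟩ w

/-- The linear map `ρ^N` from intertwining operators to `A^N(V)`-module maps. -/
noncomputable def rho (N : ℕ) : Intertwiners M₁ M₂ M₃ →ₗ[ℂ] HomN M₁ M₂ M₃ N where
  toFun 𝒴 := ⟨homN 𝒴 N, homN_mem 𝒴 N⟩
  map_add' 𝒴 𝒵 := by
    refine Subtype.ext (homN_ext fun B w => ?_)
    simp only [Submodule.coe_add, LinearMap.add_apply, coe_homN_tmulN, classN, thetaInf_mkInf,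
      theta_eq_sum _ B.2, thetaEntry_add, Finset.sum_add_distrib]
  map_smul' c 𝒴 := by
    refine Subtype.ext (homN_ext fun B w => ?_)
    simp only [Submodule.coe_smul, LinearMap.smul_apply, coe_homN_tmulN, classN, thetaInf_mkInf,
      theta_eq_sum _ B.2, thetaEntry_smul, Finset.smul_sum, RingHom.id_apply]

theorem rho_apply (N : ℕ) (B : UN W₁ N) (w : Omega M₂.gr N) :
    ((rho N 𝒴 : TensorN M₁ M₂ N →ₗ[ℂ] Omega M₃.gr N) (tmulN M₁ M₂ N (classN M₁ N B) w) : W₃)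
      = theta 𝒴 B w :=
  coe_homN_tmulN 𝒴 N _ w

end Intertwiners

end Rho

/-! ### The graded dual and weight-raising operators. -/

namespace LBModule

variable {W : Type u} [AddCommGroup W] [Module ℂ W] (M : LBModule 𝒱 W)

theorem dual_comp_proj_mem (f : Module.Dual ℂ W) (h : ℂ) : f ∘ₗ M.proj h ∈ M.dualGr h := by
  intro h' hh w hw
  rw [LinearMap.comp_apply, M.proj_of_mem_ne hh hw, map_zero]

theorem dualGr_eq_bot_iff (h : ℂ) : M.dualGr h = ⊥ ↔ M.gr h = ⊥ := by
  constructor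
  · intro hd
    refine (Submodule.eq_bot_iff _).2 fun w hw => ?_
    refine (Module.forall_dual_apply_eq_zero_iff ℂ w).1 fun f => ?_
    have := M.dual_comp_proj_mem f h
    rw [hd, Submodule.mem_bot] at this
    rw [← M.proj_of_mem hw]
    exact LinearMap.congr_fun this w
  · intro hg
    refine (Submodule.eq_bot_iff _).2 fun f hf => ?_
    refine ext_of_isInternal M.isInternal fun h' w hw => ?_
    by_cases hh : h' = h
    · rw [hh, hg, Submodule.mem_bot] at hw
      simp [hw]
    · exact hf h' hh w hw

/-- Hence the levels of $W'$ are indexed by the same weights as those of $W$, and minimal weights of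
$W_3'$ can be used in $\vartheta_{\mathcal Y}$. -/
theorem minWeights_dualGr : minWeights M.dualGr = minWeights M.gr := by
  ext h
  simp [minWeights, dualGr_eq_bot_iff]

theorem eq_zero_of_gradedDual {w : W} (h : ∀ f ∈ M.gradedDual, f w = 0) : w = 0 := by
  refine M.ext_proj fun t => ?_
  rw [map_zero]
  refine (Module.forall_dual_apply_eq_zero_iff ℂ _).1 fun f => ?_
  exact h _ (Submodule.mem_iSup_of_mem t (M.dual_comp_proj_mem f t))

/-- The transpose of an operator that raises weights by `d ≥ 0` preserves `Ω_N^0(W')`. -/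
theorem comp_mem_Omega_dualGr {N d : ℕ} {T : Module.End ℂ W}
    (hT : ∀ t, ∀ w ∈ M.gr t, T w ∈ M.gr (t + d)) {f : Module.Dual ℂ W}
    (hf : f ∈ Omega M.dualGr N) : f ∘ₗ T ∈ Omega M.dualGr N := by
  suffices h : Omega M.dualGr N ≤ (Omega M.dualGr N).comap (LinearMap.lcomp ℂ ℂ T) from h hf
  refine iSup₂_le fun n hn => iSup₂_le fun h hh f hf => ?_
  change f ∘ₗ T ∈ Omega M.dualGr N
  -- Transposition turns raising by $d$ into lowering by $d$: level $n$ goes to level $n-d$ if $d\le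
  -- n$, and otherwise below the minimal weight, hence to zero.
  have key : f ∘ₗ T ∈ M.dualGr (h + n - d) := by
    intro t ht w hw
    exact hf (t + d) (fun e => ht (by rw [← e]; ring)) _ (hT t w hw)
  rcases le_or_gt d n with hd | hd
  · refine Submodule.mem_iSup_of_mem (n - d) (Submodule.mem_iSup_of_mem ?_
      (Submodule.mem_iSup_of_mem h (Submodule.mem_iSup_of_mem hh ?_)))
    · simp only [Finset.mem_range] at hn ⊢
      omega
    · rwa [Nat.cast_sub hd, ← add_sub_assoc]
  · rw [show h + (n : ℂ) - d = h - ((d - n : ℕ) : ℂ) by rw [Nat.cast_sub hd.le]; ring,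
      hh.2 _ (by omega), Submodule.mem_bot] at key
    rw [key]
    exact Submodule.zero_mem _

theorem L0_mem_gr {t : ℂ} {w : W} (hw : w ∈ M.gr t) : M.L0 w ∈ M.gr t :=
  Module.End.mapsTo_maxGenEigenspace_of_comm (Commute.refl M.L0) t hw

theorem Lm1_mem_gr {t : ℂ} {w : W} (hw : w ∈ M.gr t) : M.Lm1 w ∈ M.gr (t + 1) := by
  have key : ∀ (j : ℕ) (w : W), ((M.L0 - (t + 1) • (1 : Module.End ℂ W)) ^ j) (M.Lm1 w)
      = M.Lm1 (((M.L0 - t • (1 : Module.End ℂ W)) ^ j) w) := by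
    intro j
    induction j with
    | zero => intro w; simp
    | succ j ih =>
      intro w
      have h1 := M.L0_Lm1_bracket w
      rw [sub_eq_iff_eq_add] at h1
      rw [pow_succ, pow_succ, Module.End.mul_apply, Module.End.mul_apply, ← ih]
      congr 1
      simp only [LinearMap.sub_apply, LinearMap.smul_apply, Module.End.one_apply, map_sub,
        map_smul, h1]
      module
  unfold gr at hw ⊢
  rw [Module.End.mem_maxGenEigenspace] at hw ⊢
  obtain ⟨j, hj⟩ := hw
  exact ⟨j, by rw [key, hj, map_zero]⟩

end LBModule

/-! ### Injectivity of $\rho^N$. -/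

section Injectivity

variable {W₁ W₂ W₃ : Type u} [AddCommGroup W₁] [Module ℂ W₁] [AddCommGroup W₂] [Module ℂ W₂]
  [AddCommGroup W₃] [Module ℂ W₃]
  {M₁ : LBModule 𝒱 W₁} {M₂ : LBModule 𝒱 W₂} {M₃ : LBModule 𝒱 W₃}

namespace Intertwiners

variable (𝒴 : Intertwiners M₁ M₂ M₃)

/-- Test on the matrix with the single entry $w_1$ at $(k,l)$, which lies in $U^N(W_1)$ because
$k,l\le N$. -/
theorem thetaEntry_eq_zero {N : ℕ}
    (h : ∀ B ∈ UN W₁ N, ∀ w ∈ Omega M₂.gr N, theta 𝒴 B w = 0) {k l : ℕ} (hk : k ≤ N) (hl : l ≤ N)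
    (w₁ : W₁) {w₂ : W₂} (hw : w₂ ∈ Omega M₂.gr N) : thetaEntry 𝒴 k l w₁ w₂ = 0 := by
  classical
  let B : UInf W₁ := ⟨Pi.single k (Pi.single l w₁), fun j => (Set.finite_singleton k).subset
    fun i hi => by
      by_contra hc
      exact hi (by simp [Pi.single_eq_of_ne (M := fun _ : ℕ => ℕ → W₁) hc])⟩
  have hB : B ∈ UN W₁ N := by
    intro i j hij
    change (Pi.single k (Pi.single l w₁) : ℕ → ℕ → W₁) i j = 0
    rcases hij with hi | hj
    · rw [Pi.single_eq_of_ne (by omega)]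
      rfl
    · by_cases hi : i = k
      · rw [hi, Pi.single_eq_same, Pi.single_eq_of_ne (by omega)]
      · rw [Pi.single_eq_of_ne hi]
        rfl
  rw [← h B hB w₂ hw, theta_eq_sum 𝒴 hB, Finset.sum_eq_single_of_mem k (by simp; omega),
    Finset.sum_eq_single_of_mem l (by simp; omega)]
  · simp [B]
  · intro j _ hj
    simp [B, Pi.single_eq_of_ne hj]
  · intro i _ hi
    simp [B, Pi.single_eq_of_ne (M := fun _ : ℕ => ℕ → W₁) hi]

theorem dual_apply_eq_zero_of_Omega {N : ℕ}
    (h : ∀ B ∈ UN W₁ N, ∀ w ∈ Omega M₂.gr N, theta 𝒴 B w = 0) {f : Module.Dual ℂ W₃}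
    (hf : f ∈ Omega M₃.dualGr N) {w₂ : W₂} (hw : w₂ ∈ Omega M₂.gr N) (n : ℂ) (w₁ : W₁) :
    f (𝒴.1 n 0 w₁ w₂) = 0 := by
  classical
  have hdual : Omega M₃.dualGr N ≤ LinearMap.ker (Module.Dual.eval ℂ W₃ (𝒴.1 n 0 w₁ w₂)) := by
    refine iSup₂_le fun k hk => iSup₂_le fun h₃ hh₃ f hf => ?_
    rw [M₃.minWeights_dualGr] at hh₃
    rw [LinearMap.mem_ker, Module.Dual.eval_apply]
    have hker : Omega M₂.gr N ≤ LinearMap.ker (f ∘ₗ 𝒴.1 n 0 w₁) := by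
      refine iSup₂_le fun l hl => iSup₂_le fun h₂ hh₂ w₂ hw₂ => ?_
      rw [LinearMap.mem_ker]
      have hΩ : w₂ ∈ Omega M₂.gr N :=
        Submodule.mem_iSup_of_mem l (Submodule.mem_iSup_of_mem hl
          (Submodule.mem_iSup_of_mem h₂ (Submodule.mem_iSup_of_mem hh₂ hw₂)))
      suffices h0 : f ∘ₗ (𝒴.1 n 0).flip w₂ = 0 from LinearMap.congr_fun h0 w₁
      refine ext_of_isInternal M₁.isInternal fun b w₁ hw₁ => ?_
      change f (𝒴.1 n 0 w₁ w₂) = 0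
      -- If the weight of the coefficient agrees with that of $f$, the coefficient is a component of
      -- an entry of $\vartheta_{\mathcal Y}$, which vanishes. If not, $f$ kills it by degree.
      by_cases ht : b + (h₂ + l) - n - 1 = h₃ + k
      · have e := proj_thetaEntry 𝒴 k l hw₁ hw₂ (h₃ + k)
        rw [thetaEntry_eq_zero 𝒴 h (Nat.lt_succ_iff.1 (Finset.mem_range.1 hk))
          (Nat.lt_succ_iff.1 (Finset.mem_range.1 hl)) w₁ hΩ, add_sub_cancel_right,
          add_sub_cancel_right, if_pos ⟨hh₂, hh₃⟩, map_zero,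
          show b + (h₂ + l) - (h₃ + k) - 1 = n by rw [← ht]; ring] at e
        rw [← e, map_zero]
      · exact hf _ ht _ (𝒴.2.mem_gr n 0 hw₁ hw₂)
    exact hker hw
  exact hdual hf

/-- The vectors `w₂` such that `⟨f, 𝒴⁰(w₁, x) w₂⟩ = 0` for all `w₁` and all `f` in `Ω_N^0(W₃')`. -/
def omegaKernel (N : ℕ) : Submodule ℂ W₂ where
  carrier := {w₂ | ∀ f ∈ Omega M₃.dualGr N, ∀ n w₁, f (𝒴.1 n 0 w₁ w₂) = 0}
  zero_mem' := fun f _ n w₁ => by simp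
  add_mem' := fun h h' f hf n w₁ => by simp [h f hf n w₁, h' f hf n w₁]
  smul_mem' := fun c _ h f hf n w₁ => by simp [h f hf n w₁]

/-- $\Omega_N^0(W_3')$ is only stable under transposes of operators that do not lower weights, so
the commutator formula is not enough. The Jacobi identity is used with $r$ chosen to leave only such
operators on $W_3$. -/
theorem Y_mem_omegaKernel_of_mem {N : ℕ} {a : ℤ} {v : V} (hv : v ∈ 𝒱.gr a) {w₂ : W₂}
    (hw : w₂ ∈ omegaKernel 𝒴 N) (p : ℤ) : M₂.Y p v w₂ ∈ omegaKernel 𝒴 N := by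
  obtain ⟨K, hK⟩ := M₂.truncation v w₂
  -- Descending induction on $p$ from the truncation bound: the identity for $p$ also involves the
  -- modes with index $p+i$, $i>0$.
  have down : ∀ d : ℕ, ∀ p, K ≤ p + d → M₂.Y p v w₂ ∈ omegaKernel 𝒴 N := by
    intro d
    induction d with
    | zero =>
      intro p hp
      rw [hK p (by omega)]
      exact Submodule.zero_mem _
    | succ d ih =>
      intro p hp f hf q w₁
      -- With $r=a-1-p$ the modes on $W_3$ have index $a-1-i$ and raise weights by $i\ge0$. The
      -- shift of $q$ by $-r$ makes the $i=0$ term the coefficient with index $q$.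
      have hJ := congrArg f (𝒴.2.jacobi 0 v w₁ w₂ p (a - 1 - p) (q - (a - 1 - p : ℤ)))
      have hL := f.toAddMonoidHom.map_finsum
        (jacobi_left_finite (M₂ := M₂) (M₃ := M₃) 𝒴.2.truncation 0 v w₁ w₂ p (a - 1 - p)
          (q - (a - 1 - p : ℤ)))
      have hR := f.toAddMonoidHom.map_finsum
        (jacobi_right_finite (M₁ := M₁) 𝒴.1 0 v w₁ w₂ p (a - 1 - p) (q - (a - 1 - p : ℤ)))
      simp only [LinearMap.toAddMonoidHom_coe] at hL hR
      beta_reduce at hJ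
      rw [hL, hR] at hJ
      have hY : ∀ i : ℕ, ∀ n, f (M₃.Y (p + (a - 1 - p) - i) v (𝒴.1 n 0 w₁ w₂)) = 0 := by
        intro i n
        refine hw _ (M₃.comp_mem_Omega_dualGr (d := i) (T := M₃.Y (p + (a - 1 - p) - i) v)
          (fun t w hw => M₃.Y_mem_gr_of_eq hv hw ?_) hf) n w₁
        push_cast
        ring
      rw [finsum_eq_zero_of_forall_eq_zero (f := fun i : ℕ => f (((Ring.choose p i : ℤ) : ℂ) • _))
        fun i => by rw [map_smul, hw f hf, smul_zero], finsum_eq_single _ 0] at hJ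
      · simp only [map_smul, map_sub, hY, zero_sub] at hJ
        have hpow : (-1 : ℂ) ^ (a - 1 - p) ≠ 0 := zpow_ne_zero _ (by norm_num)
        simpa [hpow] using hJ
      · intro i hi
        rw [map_smul, map_sub, map_smul, hY, ih (p + i) (by omega) f hf]
        simp
  exact down (K - p).toNat p (by omega)

theorem isSubmodule_omegaKernel (N : ℕ) : M₂.IsSubmodule (omegaKernel 𝒴 N) := by
  have hLm1 : ∀ w ∈ omegaKernel 𝒴 N, M₂.Lm1 w ∈ omegaKernel 𝒴 N := by
    intro w hw f hf n w₁
    have h1 := congrArg f (𝒴.2.Lm1_bracket n 0 w₁ w)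
    have h2 : f (M₃.Lm1 (𝒴.1 n 0 w₁ w)) = 0 :=
      hw _ (M₃.comp_mem_Omega_dualGr (d := 1) (T := M₃.Lm1)
        (fun t w hw => by simpa using M₃.Lm1_mem_gr hw) hf) n w₁
    rw [map_sub, h2, hw f hf, zero_sub, neg_eq_zero] at h1
    exact h1
  refine ⟨fun n v w hw => ?_, fun w hw f hf n w₁ => ?_, hLm1⟩
  · have : v ∈ (⨆ a, 𝒱.gr a) := by
      rw [𝒱.isInternal.submodule_iSup_eq_top]
      trivial
    have hle : (⨆ a, 𝒱.gr a) ≤ (omegaKernel 𝒴 N).comap ((M₂.Y n).flip w) :=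
      iSup_le fun a v hv => Y_mem_omegaKernel_of_mem 𝒴 hv hw n
    exact hle this
  · have h1 := congrArg f (𝒴.2.L0_bracket n 0 w₁ w)
    have h2 : f (M₃.L0 (𝒴.1 n 0 w₁ w)) = 0 :=
      hw _ (M₃.comp_mem_Omega_dualGr (d := 0) (T := M₃.L0)
        (fun t w hw => by simpa using M₃.L0_mem_gr hw) hf) n w₁
    rw [map_sub, map_add, h2, hw f hf, hw f hf, zero_sub, add_zero, neg_eq_zero] at h1
    exact h1

/-- The functionals that annihilate all coefficients of `𝒴⁰`. -/
def annihilator : Submodule ℂ (Module.Dual ℂ W₃) where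
  carrier := {f | ∀ n w₁ w₂, f (𝒴.1 n 0 w₁ w₂) = 0}
  zero_mem' := fun n w₁ w₂ => by simp
  add_mem' := fun h h' n w₁ w₂ => by simp [h n w₁ w₂, h' n w₁ w₂]
  smul_mem' := fun c _ h n w₁ w₂ => by simp [h n w₁ w₂]

/-- The case $r=0$ of the Jacobi identity is the commutator formula. Apart from $v$ acting on a
coefficient of $\mathcal Y^0$, all its terms are multiples of such coefficients, which $f$ kills. -/
theorem comp_Y_mem_annihilator {f : Module.Dual ℂ W₃} (hf : f ∈ annihilator 𝒴) (p : ℤ) (v : V) :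
    f ∘ₗ M₃.Y p v ∈ annihilator 𝒴 := by
  intro q w₁ w₂
  have hJ := congrArg f (𝒴.2.jacobi 0 v w₁ w₂ p 0 q)
  have hR := f.toAddMonoidHom.map_finsum (jacobi_right_finite (M₁ := M₁) 𝒴.1 0 v w₁ w₂ p 0 q)
  simp only [LinearMap.toAddMonoidHom_coe] at hR
  beta_reduce at hJ
  rw [hR, finsum_eq_zero_of_forall_eq_zero
    (f := fun i : ℕ => f (((Ring.choose p i : ℤ) : ℂ) • _))
    fun i => by rw [map_smul, hf, smul_zero], finsum_eq_single _ 0] at hJ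
  · simpa [hf _ _ _] using hJ
  · intro i hi
    rw [Ring.choose_zero_pos ℤ (Nat.pos_of_ne_zero hi)]
    simp

/-- With or without a conformal vector, the operators on $W_3'$ are sums of multiples of transposes
of modes of $Y_{W_3}$, so invariance under these transposes suffices. -/
theorem dualY_mem_annihilator {f : Module.Dual ℂ W₃} (hf : f ∈ annihilator 𝒴) (n : ℤ) (v : V) :
    M₃.dualY n v f ∈ annihilator 𝒴 := by
  unfold LBModule.dualY
  split
  · rename_i ω _
    let S : Submodule ℂ (Module.End ℂ W₃) :=
      (annihilator 𝒴).comap (LinearMap.llcomp ℂ W₃ W₃ ℂ f)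
    change M₃.oppositeY ω n v ∈ S
    unfold LBModule.oppositeY
    refine finsum_induction (· ∈ S) S.zero_mem (fun _ _ => S.add_mem) fun a => ?_
    refine finsum_induction (· ∈ S) S.zero_mem (fun _ _ => S.add_mem) fun i => ?_
    exact S.smul_mem _ (comp_Y_mem_annihilator 𝒴 hf _ _)
  · exact comp_Y_mem_annihilator 𝒴 hf n v

/-- The coefficient of `(log x)^0` determines an intertwining operator. -/
theorem eq_zero_of_log_zero (h : ∀ n w₁ w₂, 𝒴.1 n 0 w₁ w₂ = 0) : 𝒴 = 0 := by
  have main : ∀ k n w₁ w₂, 𝒴.1 n k w₁ w₂ = 0 := by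
    intro k
    induction k with
    | zero => exact h
    | succ k ih =>
      intro n w₁ w₂
      -- This expresses $(k+1)\mathcal Y_{n,k+1}$ through coefficients of $(\log x)^k$, which vanish
      -- by induction.
      have h1 := 𝒴.2.Lm1_derivative (n + 1) k w₁ w₂
      rw [ih, ih, smul_zero, zero_add, add_sub_cancel_right] at h1
      exact (smul_eq_zero.1 h1.symm).resolve_left (Nat.cast_add_one_ne_zero k)
  apply Subtype.ext
  funext n k
  exact LinearMap.ext₂ fun w₁ w₂ => main k n w₁ w₂

/-- An intertwining operator `𝒴` vanishes if `ϑ_𝒴` vanishes on `U^N(W₁)` and `Ω_N^0(W₂)`, provided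
that `W₂` and `W₃'` are generated by `Ω_N^0(W₂)` and `Ω_N^0(W₃')`. -/
theorem eq_zero_of_theta_eq_zero {N : ℕ} (h₂ : M₂.GeneratedBy (Omega M₂.gr N))
    (h₃ : M₃.DualGeneratedBy (Omega M₃.dualGr N))
    (h : ∀ B ∈ UN W₁ N, ∀ w ∈ Omega M₂.gr N, theta 𝒴 B w = 0) : 𝒴 = 0 := by
  have htop : omegaKernel 𝒴 N = ⊤ := h₂ _ (isSubmodule_omegaKernel 𝒴 N) fun w hw f hf n w₁ =>
    dual_apply_eq_zero_of_Omega 𝒴 h hf hw n w₁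
  have hann : M₃.gradedDual ≤ annihilator 𝒴 := by
    refine h₃ _ (fun n v f hf => dualY_mem_annihilator 𝒴 hf n v) fun f hf n w₁ w₂ => ?_
    have hw : w₂ ∈ omegaKernel 𝒴 N := htop ▸ Submodule.mem_top
    exact hw f hf n w₁
  exact eq_zero_of_log_zero 𝒴 fun n w₁ w₂ =>
    M₃.eq_zero_of_gradedDual fun f hf => hann hf n w₁ w₂

theorem rho_injective {N : ℕ} (h₂ : M₂.GeneratedBy (Omega M₂.gr N))
    (h₃ : M₃.DualGeneratedBy (Omega M₃.dualGr N)) :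
    Function.Injective (rho (M₁ := M₁) (M₂ := M₂) (M₃ := M₃) N) := by
  refine (injective_iff_map_eq_zero _).2 fun 𝒴 h𝒴 => ?_
  refine eq_zero_of_theta_eq_zero 𝒴 h₂ h₃ fun B hB w hw => ?_
  rw [← rho_apply 𝒴 N ⟨B, hB⟩ ⟨w, hw⟩, h𝒴]
  rfl

end Intertwiners

end Injectivity

end VertexAlg

theorem proposition6p1 {V W₁ W₂ W₃ : Type u} [AddCommGroup V] [Module ℂ V]
    [AddCommGroup W₁] [Module ℂ W₁] [AddCommGroup W₂] [Module ℂ W₂]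
    [AddCommGroup W₃] [Module ℂ W₃]
    (𝒱 : VertexAlgebra V) (M₁ : LBModule 𝒱 W₁) (M₂ : LBModule 𝒱 W₂) (M₃ : LBModule 𝒱 W₃) (N : ℕ)
    (h₂ : M₂.GeneratedBy (Omega M₂.gr N)) (h₃ : M₃.DualGeneratedBy (Omega M₃.dualGr N)) :
    ∃ ρ : Intertwiners M₁ M₂ M₃ →ₗ[ℂ] HomN M₁ M₂ M₃ N,
      (∀ (𝒴 : Intertwiners M₁ M₂ M₃) (B : UN W₁ N) (w₂ : Omega M₂.gr N),
        ((ρ 𝒴 : TensorN M₁ M₂ N →ₗ[ℂ] Omega M₃.gr N) (tmulN M₁ M₂ N (classN M₁ N B) w₂) : W₃)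
          = Intertwiners.theta 𝒴 B w₂) ∧
      Function.Injective ρ := by
  exact ⟨Intertwiners.rho N, fun 𝒴 B w₂ => Intertwiners.rho_apply 𝒴 N B w₂,
    Intertwiners.rho_injective h₂ h₃⟩
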